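/- There are absolute constants $c, C_1, C_2, C_3 > 0$ such that the following holds for all integers $d \ge 2$, $m \ge 0$ and $r$. Write $\langle A, B\rangle = \mathrm{tr}(A^\top B)$ and let $\|\cdot\|_F$ be the Frobenius norm. Let $X^\star \in \mathbb{R}^{d\times d}$ be a symmetric positive semidefinite matrix of rank $r$ with spectral norm $1$, and let $\kappa = 1/\sigma_r(X^\star)$, where $\sigma_r$ denotes the $r$-th largest singular value. Let $A_1,\dots,A_m \in \mathbb{R}^{d\times d}$ be symmetric matrices, let $y_i = \langle A_i, X^\star\rangle$, and let $$ f(U) = \frac{1}{2m}\sum_{i=1}^m \bigl(y_i - \langle A_i, UU^\top\rangle\bigr)^2, \qquad U\in\mathbb{R}^{d\times d}. $$ Assume that $(A_1,\dots,A_m)$ satisfies the $(4r,\delta)$-restricted isometry property, that is, $$ (1-\delta)\|X\|_F^2 \le \frac1m\sum_{i=1}^m \langle A_i, X\rangle^2 \le (1+\delta)\|X\|_F^2 $$ for every symmetric $X\in\mathbb{R}^{d\times d}$ of rank at most $4r$, with $\delta \le c/(\kappa^3\sqrt r\,\log^2 d)$. Let $B\in\mathbb{R}^{d\times d}$ be any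 orthogonal matrix, $U_0=\alpha B$ and $U_{t+1} = U_t - \eta\nabla f(U_t)$ for $t\ge 0$, where $0<\alpha\le c\min\{\delta\sqrt r\,\kappa,\ 1/d\}$ and $0<\eta\le c\delta$. Then for every integer $T$ with $$ C_1\,\frac{\kappa\log(d/\alpha)}{\eta} \;\le\; T \;\le\; \frac{C_2}{\eta\sqrt{d\kappa\alpha}} $$ we have $$ \|U_TU_T^\top - X^\star\|_F^2 \;\le\; C_3\,\frac{\alpha\sqrt d}{\kappa^2}. $$ -/

import Mathlib

-- `‖X‖` for a real matrix `X` denotes the Frobenius norm.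
open scoped Matrix Matrix.Norms.Frobenius

noncomputable section

namespace MatrixSensing

/-- The inner product `⟨A, B⟩ = tr(Aᵀ B)` of two real square matrices. -/
def matInner {d : ℕ} (A B : Matrix (Fin d) (Fin d) ℝ) : ℝ :=
  (Aᵀ * B).trace

/-- The spectral norm of a real square matrix: its operator norm on Euclidean space. -/
def specNorm {d : ℕ} (X : Matrix (Fin d) (Fin d) ℝ) : ℝ :=
  ‖Matrix.toEuclideanCLM (𝕜 := ℝ) X‖

/-- The `k`-th largest singular value of a real square matrix, for `k = 1, 2, …`
(Mathlib's `LinearMap.singularValues` counts from `0`). -/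
def sigma {d : ℕ} (k : ℕ) (X : Matrix (Fin d) (Fin d) ℝ) : ℝ :=
  (Matrix.toEuclideanLin (𝕜 := ℝ) X).singularValues (k - 1)

/-- The condition number `κ = 1 / σ_r(X)` of a matrix of rank `r` and spectral norm one. -/
def condNumber {d : ℕ} (X : Matrix (Fin d) (Fin d) ℝ) : ℝ :=
  1 / sigma X.rank X

/-- The `(k, δ)`-restricted isometry property of a family of symmetric measurement matrices.
The test matrices `X` range over the symmetric matrices of rank at most `k`: a symmetric `A i` is
orthogonal to every antisymmetric matrix, so the lower bound can only hold for symmetric `X`. -/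
def RIP {d m : ℕ} (A : Fin m → Matrix (Fin d) (Fin d) ℝ) (k : ℕ) (δ : ℝ) : Prop :=
  ∀ X : Matrix (Fin d) (Fin d) ℝ, X.IsSymm → X.rank ≤ k →
    (1 - δ) * ‖X‖ ^ 2 ≤ 1 / (m : ℝ) * ∑ i, matInner (A i) X ^ 2 ∧
    1 / (m : ℝ) * ∑ i, matInner (A i) X ^ 2 ≤ (1 + δ) * ‖X‖ ^ 2

/-- The over-parameterized squared loss
`f(U) = (1 / 2m) ∑ᵢ (yᵢ - ⟨Aᵢ, U Uᵀ⟩)²`, for `U` of size `d × d`. -/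
def loss {d m : ℕ} (A : Fin m → Matrix (Fin d) (Fin d) ℝ) (y : Fin m → ℝ)
    (U : Matrix (Fin d) (Fin d) ℝ) : ℝ :=
  1 / (2 * (m : ℝ)) * ∑ i, (y i - matInner (A i) (U * Uᵀ)) ^ 2

/-- The gradient of a function of a matrix: the matrix of its partial derivatives. -/
def matGradient {d : ℕ} (f : Matrix (Fin d) (Fin d) ℝ → ℝ) (U : Matrix (Fin d) (Fin d) ℝ) :
    Matrix (Fin d) (Fin d) ℝ :=
  Matrix.of fun i j => deriv (fun s : ℝ => f (U + s • Matrix.single i j (1 : ℝ))) 0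

/-- The iterates of gradient descent with step size `η` from `U₀`:
`U_{t+1} = U_t - η ∇f(U_t)`. -/
def gradientDescent {d : ℕ} (f : Matrix (Fin d) (Fin d) ℝ → ℝ) (η : ℝ)
    (U₀ : Matrix (Fin d) (Fin d) ℝ) : ℕ → Matrix (Fin d) (Fin d) ℝ
  | 0 => U₀
  | t + 1 => gradientDescent f η U₀ t - η • matGradient f (gradientDescent f η U₀ t)

end MatrixSensing

end

/-! Write `G = U Uᵀ`, `W = Uᵀ`, and let `S₀` be the range of the target `X`. One gradient step
multiplies `U` on the left by the symmetric matrix `A = 1 - 2η (G - X + D)`, where `D` is the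
deviation of the empirical measurement operator from the identity, evaluated at `G - X`. So `W`
becomes `W A` and `G` becomes `A G A`; the abstract part works with these operators and calls the
step size `η` instead of `2η`.

The state is summarised by a moving subspace `S` of dimension `rank X`, replaced by `A S` at each
step. `IsSplitting` records a noise level `e` on `Sᗮ`, a signal level `σ` on `S`, and a slope `τ` of
`S` over `S₀`. With `s = 1/κ` and `ω` a bound for `D`, one step gives (`noise_step`, `signal_step`,
`tilt_step`): `e` grows by at most `1 + η (τ² + ω)`; `σ` grows by `1 + η s / 10` while `σ² ≤ s /
20`; and `τ` contracts by `1 - η s / 2` up to an error of order `η (e + ω)`. The noise rate contains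
`τ²` and not `τ` because the quadratic form of `X` on `Sᗮ` is of second order in the slope. Once `σ²
= s / 20`, the restriction of `G - X` to `S₀`, of size `ψ`, contracts by `1 - η s / 120` up to `5 η
ω` (`residual_step`).

`G - X` has full rank, so the isometry property cannot be applied to it directly.
`RIP.error_norm_le` splits it into a part of rank at most `3r` and a positive remainder on `Sᗮ`,
which is a sum of rank-one matrices of total norm at most `d e²`; hence `ω` is at most `δ (√(3r) ξ +
d e²)`, where `ξ` bounds the low-rank part.

In `growth_phase` the signal rises from `α` to order `√s`, while the noise, growing far more slowly,
only reaches order `α (d/α)^(1/8)`. In `convergence_phase` the noise must not grow by more than a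
constant factor. The potential `e * exp (τ / 1000 + ψ / 10)` shows this: the noise growth caused by
`τ` and `ψ` is paid for by their decay, and what remains is a rate of order `ebar + δ d ebar²`, with
`ebar` the cap on the noise, which is harmless for the allowed number of steps. At the end only the
noise floor and an exponentially small term are left. The upper and lower bounds on `T` together
force `√(dα)` to be small compared with `s^(3/2)`, which makes the floor smaller than the claimed
accuracy (`exists_noise_radius`). -/

noncomputable section

namespace MatrixSensing

open scoped InnerProductSpace

/-! ### Abstract operators: Gram pairs, the target, and splittings. -/

section

variable {E : Type*} [NormedAddCommGroup E] [InnerProductSpace ℝ E]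

/-- `G = Wᵀ W` with `‖W‖² ≤ 2`. -/
structure IsGram (G W : E →L[ℝ] E) : Prop where
  inner_eq : ∀ x y, ⟪G x, y⟫_ℝ = ⟪W x, W y⟫_ℝ
  sq_le : ∀ y, ‖W y‖ ^ 2 ≤ 2 * ‖y‖ ^ 2

/-- A symmetric operator of norm at most one, with range in `S₀` and at least `s` on `S₀`. -/
structure IsTarget (X : E →L[ℝ] E) (S₀ : Submodule ℝ E) (s : ℝ) : Prop where
  symm : ∀ x y, ⟪X x, y⟫_ℝ = ⟪x, X y⟫_ℝ
  mem : ∀ x, X x ∈ S₀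
  norm_le : ∀ x, ‖X x‖ ≤ ‖x‖
  lower : ∀ v ∈ S₀, s * ‖v‖ ^ 2 ≤ ⟪v, X v⟫_ℝ

/-- A symmetric operator of norm at most `ω`. -/
structure IsSmallSymm (D : E →L[ℝ] E) (ω : ℝ) : Prop where
  symm : ∀ x y, ⟪D x, y⟫_ℝ = ⟪x, D y⟫_ℝ
  norm_le : ∀ x, ‖D x‖ ≤ ω * ‖x‖

/-- `S` carries the part of size at least `σ` of `W`, its complement the part of size at most `e`,
and `S` is a graph of slope at most `τ` over `S₀`. -/
structure IsSplitting (W : E →L[ℝ] E) (S₀ S : Submodule ℝ E) [S₀.HasOrthogonalProjection]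
    (e σ τ : ℝ) : Prop where
  noise : ∀ k ∈ Sᗮ, ‖W k‖ ≤ e * ‖k‖
  signal : ∀ y ∈ S, σ * ‖y‖ ≤ ‖W y‖
  tilt : ∀ y ∈ S, ‖y - S₀.starProjection y‖ ≤ τ * ‖S₀.starProjection y‖
  finrank_eq : Module.finrank ℝ S = Module.finrank ℝ S₀

variable {G W X D : E →L[ℝ] E} {S₀ S : Submodule ℝ E} {s ω e σ τ η : ℝ}

theorem IsGram.symm (h : IsGram G W) (x y : E) : ⟪G x, y⟫_ℝ = ⟪x, G y⟫_ℝ := by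
  rw [h.inner_eq, real_inner_comm, ← h.inner_eq, real_inner_comm]

theorem IsGram.inner_self (h : IsGram G W) (x : E) : ⟪G x, x⟫_ℝ = ‖W x‖ ^ 2 := by
  rw [h.inner_eq, real_inner_self_eq_norm_sq]

theorem IsGram.norm_le' (h : IsGram G W) (y : E) : ‖W y‖ ≤ √2 * ‖y‖ := by
  apply abs_le_of_sq_le_sq' _ (by positivity) |>.2
  rw [mul_pow, Real.sq_sqrt (by norm_num)]; exact h.sq_le y

theorem IsGram.norm_le (h : IsGram G W) (y : E) : ‖W y‖ ≤ 3 / 2 * ‖y‖ := by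
  have := h.sq_le y
  apply abs_le_of_sq_le_sq' _ (by positivity) |>.2
  nlinarith [sq_nonneg ‖y‖]

theorem IsGram.inner_le (h : IsGram G W) (x y : E) : |⟪G x, y⟫_ℝ| ≤ ‖W x‖ * ‖W y‖ := by
  rw [h.inner_eq]; exact abs_real_inner_le_norm _ _

theorem norm_le_of_inner_self_le {z : E} {a : ℝ} (h : ⟪z, z⟫_ℝ ≤ a * ‖z‖) (ha : 0 ≤ a) :
    ‖z‖ ≤ a := by
  rw [real_inner_self_eq_norm_sq] at h
  by_contra! hc
  have : 0 < ‖z‖ := lt_of_le_of_lt ha hc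
  nlinarith

theorem IsGram.norm_apply_le (h : IsGram G W) (x : E) : ‖G x‖ ≤ 2 * ‖x‖ := by
  apply norm_le_of_inner_self_le _ (by positivity)
  have h1 := le_trans (le_abs_self _) (h.inner_le x (G x))
  have h2 := h.norm_le' x
  have h3 := h.norm_le' (G x)
  have h4 : √2 * √2 = 2 := Real.mul_self_sqrt (by norm_num)
  calc _ ≤ _ := h1
    _ ≤ (√2 * ‖x‖) * (√2 * ‖G x‖) := by gcongr
    _ = (√2 * √2) * (‖x‖ * ‖G x‖) := by ring
    _ = _ := by rw [h4]; ring

theorem IsTarget.nonneg [S₀.HasOrthogonalProjection] (h : IsTarget X S₀ s) (x : E) :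
    ⟪x, X x⟫_ℝ = ⟪S₀.starProjection x, X (S₀.starProjection x)⟫_ℝ := by
  have h1 : ∀ a b : E, ⟪a, X b⟫_ℝ = ⟪S₀.starProjection a, X b⟫_ℝ := fun a b => by
    have := S₀.starProjection_inner_eq_zero a (X b) (h.mem b)
    rw [inner_sub_left] at this; linarith
  rw [h1, ← h.symm, real_inner_comm, h1, ← h.symm, real_inner_comm]

theorem IsTarget.apply_starProjection [S₀.HasOrthogonalProjection] (h : IsTarget X S₀ s) (x : E) :
    X (S₀.starProjection x) = X x := by
  rw [← sub_eq_zero, ← map_sub, ← inner_self_eq_zero (𝕜 := ℝ), h.symm, ← neg_sub, inner_neg_left,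
    S₀.starProjection_inner_eq_zero _ _ (h.mem _), neg_zero]

/-- The descent direction `G - X + D`. -/
theorem residual_norm_le (hG : IsGram G W) (hX : IsTarget X S₀ s) (hD : IsSmallSymm D ω)
    (hω : ω ≤ 1) (x : E) : ‖(G - X + D) x‖ ≤ 4 * ‖x‖ := by
  have h1 := hG.norm_apply_le x
  have h2 := hX.norm_le x
  have h3 := hD.norm_le x
  have h4 : ‖(G - X + D) x‖ ≤ ‖G x‖ + ‖X x‖ + ‖D x‖ := by
    simp only [add_apply, sub_apply]
    exact (norm_add_le _ _).trans (by gcongr; exact norm_sub_le _ _)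
  nlinarith [norm_nonneg x]

theorem residual_symm (hG : IsGram G W) (hX : IsTarget X S₀ s) (hD : IsSmallSymm D ω) (x y : E) :
    ⟪(G - X + D) x, y⟫_ℝ = ⟪x, (G - X + D) y⟫_ℝ := by
  simp only [add_apply, sub_apply, inner_add_left,
    inner_sub_left, inner_add_right, inner_sub_right, hG.symm, hX.symm, hD.symm]

theorem step_symm {M : E →L[ℝ] E} (hM : ∀ x y, ⟪M x, y⟫_ℝ = ⟪x, M y⟫_ℝ) (η : ℝ) (x y : E) :
    ⟪(1 - η • M) x, y⟫_ℝ = ⟪x, (1 - η • M) y⟫_ℝ := by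
  simp [inner_sub_left, inner_sub_right, inner_smul_left, inner_smul_right, hM]

theorem step_norm_ge {M : E →L[ℝ] E} (hM : ∀ x, ‖M x‖ ≤ 4 * ‖x‖) (hη : 0 ≤ η) (x : E) :
    (1 - 4 * η) * ‖x‖ ≤ ‖(1 - η • M) x‖ := by
  have h1 : ‖x‖ ≤ ‖(1 - η • M) x‖ + ‖η • M x‖ := by
    have : x = (1 - η • M) x + η • M x := by simp
    exact (congrArg norm this).le.trans (norm_add_le _ _)
  rw [norm_smul, Real.norm_of_nonneg hη] at h1
  nlinarith [hM x]

theorem isGram_step_inner (hG : IsGram G W) (hX : IsTarget X S₀ s) (hD : IsSmallSymm D ω)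
    (x y : E) :
    let A := (1 - η • (G - X + D) : E →L[ℝ] E)
    ⟪A (G (A x)), y⟫_ℝ = ⟪W (A x), W (A y)⟫_ℝ := by
  intro A
  rw [step_symm (residual_symm hG hX hD), hG.inner_eq]

/-- The bound `‖W‖² ≤ 2` is self-preserving: above level 1, the norm of the target, the term `-2η ‖G
y‖²` in the expansion of the square pulls `W` back. -/
theorem isGram_step (hG : IsGram G W) (hX : IsTarget X S₀ s) (hD : IsSmallSymm D ω)
    (hω : ω ≤ 1 / 10) (hη : 0 ≤ η) (hη' : η ≤ 1 / 200) :
    let A := (1 - η • (G - X + D) : E →L[ℝ] E)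
    IsGram (A * G * A) (W * A) := by
  intro A
  refine ⟨fun x y => isGram_step_inner hG hX hD x y, fun y => ?_⟩
  have hM := residual_norm_le hG hX hD (by linarith) y
  have hA : (W * A) y = W y - η • W ((G - X + D) y) := by
    simp [A]
  rw [hA, @norm_sub_sq ℝ, inner_smul_right, norm_smul, Real.norm_of_nonneg hη]
  have h1 : ⟪W y, W ((G - X + D) y)⟫_ℝ = ‖G y‖ ^ 2 - ⟪G y, X y⟫_ℝ + ⟪G y, D y⟫_ℝ := by
    rw [← hG.inner_eq]
    simp only [add_apply, sub_apply, inner_add_right,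
      inner_sub_right, real_inner_self_eq_norm_sq]
  have h2 : ⟪G y, X y⟫_ℝ ≤ ‖G y‖ * ‖y‖ :=
    (real_inner_le_norm _ _).trans (by gcongr; exact hX.norm_le y)
  have h3 : -(‖G y‖ * (1 / 10 * ‖y‖)) ≤ ⟪G y, D y⟫_ℝ := by
    have := (abs_le.1 (abs_real_inner_le_norm (G y) (D y))).1
    have h4 : ‖D y‖ ≤ 1 / 10 * ‖y‖ := (hD.norm_le y).trans (by gcongr)
    nlinarith [norm_nonneg (G y)]
  have h5 : ‖W ((G - X + D) y)‖ ^ 2 ≤ 32 * ‖y‖ ^ 2 := by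
    have := hG.sq_le ((G - X + D) y)
    nlinarith [norm_nonneg ((G - X + D) y)]
  have h6 : ‖W y‖ ^ 2 ≤ ‖G y‖ * ‖y‖ := by
    rw [← hG.inner_self]; exact real_inner_le_norm _ _
  have h7 := hG.sq_le y
  have h8 := hG.norm_apply_le y
  simp only [RCLike.re_to_real]
  rw [h1, mul_pow]
  generalize ‖G y‖ = n at *
  generalize ‖W y‖ ^ 2 = q at *
  generalize ‖W ((G - X + D) y)‖ ^ 2 = m at *
  have hy := norm_nonneg y
  generalize ‖y‖ = a at *
  have h9 : η ^ 2 * m ≤ η * (32 / 200 * a ^ 2) := by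
    have : η ^ 2 * m ≤ η ^ 2 * (32 * a ^ 2) := by gcongr
    have : η * (η * a ^ 2) ≤ η * (1 / 200 * a ^ 2) := by gcongr
    nlinarith
  have h10 : 2 * (η * (n ^ 2 - 11 / 10 * n * a)) ≤
      2 * (η * (n ^ 2 - ⟪G y, X y⟫_ℝ + ⟪G y, D y⟫_ℝ)) := by
    gcongr; nlinarith
  -- If `‖G y‖` is large the first-order decrease beats every error; otherwise `‖W y‖² ≤ ‖G y‖ ‖y‖ ≤
  -- (6/5) ‖y‖²`, which leaves room below 2 for a small increase.
  rcases le_total (6 / 5 * a) n with hn | hn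
  · have : 0 ≤ η * (2 * (n ^ 2 - 11 / 10 * n * a) - 32 / 200 * a ^ 2) := by
      apply mul_nonneg hη; nlinarith
    nlinarith
  · have : η * (-2 * (n ^ 2 - 11 / 10 * n * a) + 32 / 200 * a ^ 2) ≤ 1 / 200 * (a ^ 2) := by
      have : -2 * (n ^ 2 - 11 / 10 * n * a) + 32 / 200 * a ^ 2 ≤ a ^ 2 := by
        nlinarith [sq_nonneg (n - 11 / 20 * a)]
      nlinarith [sq_nonneg a]
    nlinarith

section Tilt
variable [FiniteDimensional ℝ E]

theorem IsSplitting.norm_proj_sub_le (h : IsSplitting W S₀ S e σ τ) (hτ : 0 ≤ τ) {y : E}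
    (hy : y ∈ S) : ‖y - S₀.starProjection y‖ ≤ τ * ‖y‖ :=
  (h.tilt y hy).trans (by gcongr; exact S₀.norm_starProjection_apply_le y)

/-- Equal dimensions make the projection `S → S₀` bijective, so some `y ∈ S` has the same projection
`p` onto `S₀` as `k`. Then `0 = ⟪k, y⟫ = ‖p‖² + ⟪k - p, y - p⟫`, and the slope bound `‖y - p‖ ≤ τ
‖p‖` finishes. -/
theorem IsSplitting.norm_starProjection_orthogonal_le (h : IsSplitting W S₀ S e σ τ) (hτ : 0 ≤ τ)
    {k : E} (hk : k ∈ Sᗮ) : ‖S₀.starProjection k‖ ≤ τ * ‖k‖ := by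
  let f : S →ₗ[ℝ] S₀ := S₀.orthogonalProjectionOnto.toLinearMap ∘ₗ S.subtype
  have hf : ∀ y : S, (f y : E) = S₀.starProjection (y : E) := fun y => rfl
  have hinj : Function.Injective f := by
    rw [injective_iff_map_eq_zero]
    intro y hy
    have h1 : S₀.starProjection (y : E) = 0 := by rw [← hf, hy]; rfl
    have h2 := h.tilt y y.2
    rw [h1] at h2
    simpa using h2
  have hsurj := (LinearMap.injective_iff_surjective_of_finrank_eq_finrank h.finrank_eq).1 hinj
  obtain ⟨y, hy⟩ := hsurj ⟨S₀.starProjection k, S₀.starProjection_apply_mem k⟩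
  have hy' : S₀.starProjection (y : E) = S₀.starProjection k := by rw [← hf, hy]
  have h0 : ⟪k, (y : E)⟫_ℝ = 0 := S.inner_left_of_mem_orthogonal y.2 hk
  have h3 : ⟪k - S₀.starProjection k, (y : E)⟫_ℝ
      = ⟪k - S₀.starProjection k, y - S₀.starProjection (y : E)⟫_ℝ := by
    rw [inner_sub_right _ (y : E),
      S₀.starProjection_inner_eq_zero _ _ (S₀.starProjection_apply_mem _), sub_zero]
  have h4 : ⟪S₀.starProjection k, (y : E)⟫_ℝ = ‖S₀.starProjection k‖ ^ 2 := by
    have := S₀.starProjection_inner_eq_zero (y : E) _ (S₀.starProjection_apply_mem k)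
    rw [inner_sub_left, hy', real_inner_self_eq_norm_sq, real_inner_comm] at this
    linarith
  have h5 : ‖S₀.starProjection k‖ ^ 2 ≤ ‖k‖ * (τ * ‖S₀.starProjection k‖) := by
    have h6 := (abs_le.1 (abs_real_inner_le_norm (k - S₀.starProjection k)
      (y - S₀.starProjection (y : E)))).1
    have h7 : ‖k - S₀.starProjection k‖ ≤ ‖k‖ := by
      rw [← S₀.starProjection_orthogonal_val]; exact S₀ᗮ.norm_starProjection_apply_le k
    have h8 := h.tilt y y.2
    rw [hy'] at h8 h6
    have h9 : ‖k - S₀.starProjection k‖ * ‖(y : E) - S₀.starProjection k‖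
        ≤ ‖k‖ * (τ * ‖S₀.starProjection k‖) := by
      gcongr
    rw [inner_sub_left] at h3
    rw [hy'] at h3
    linarith
  apply norm_le_of_inner_self_le _ (by positivity)
  rw [real_inner_self_eq_norm_sq]; linarith

end Tilt

end

/-! ### One step of the dynamics: noise, tilt and signal. -/

section

variable {E : Type*} [NormedAddCommGroup E] [InnerProductSpace ℝ E]
variable {G W X D : E →L[ℝ] E} {S₀ S : Submodule ℝ E} {s ω e σ τ η : ℝ}

theorem sub_starProjection_norm_le (S : Submodule ℝ E) [S.HasOrthogonalProjection] (x : E) :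
    ‖x - S.starProjection x‖ ≤ ‖x‖ := by
  rw [← S.starProjection_orthogonal_val]; exact Sᗮ.norm_starProjection_apply_le x

/-- This is why the next subspace is `A S`: the noise of `W A` on its complement is then governed by
`W` on `Sᗮ`. -/
theorem mem_orthogonal_map_step {A : E →L[ℝ] E} (hA : ∀ x y, ⟪A x, y⟫_ℝ = ⟪x, A y⟫_ℝ) {k : E}
    (hk : k ∈ (S.map (A : E →ₗ[ℝ] E))ᗮ) : A k ∈ Sᗮ := by
  rw [Submodule.mem_orthogonal]
  intro u hu
  rw [← hA]
  exact Submodule.inner_right_of_mem_orthogonal (Submodule.mem_map_of_mem hu) hk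

theorem step_inner_self_nonneg {M : E →L[ℝ] E} (hM : ∀ x, ‖M x‖ ≤ 4 * ‖x‖) (hη : 0 ≤ η)
    (hη' : η ≤ 1 / 4) (x : E) : 0 ≤ ⟪x, (1 - η • M) x⟫_ℝ := by
  have h1 : ⟪x, (1 - η • M) x⟫_ℝ = ‖x‖ ^ 2 - η * ⟪x, M x⟫_ℝ := by
    simp [inner_sub_right, inner_smul_right]
  have h2 := real_inner_le_norm x (M x)
  have h3 : ‖x‖ * ‖M x‖ ≤ 4 * ‖x‖ ^ 2 := by nlinarith [hM x, norm_nonneg x]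
  have h4 : η * ⟪x, M x⟫_ℝ ≤ 1 / 4 * (4 * ‖x‖ ^ 2) := by
    calc _ ≤ η * (4 * ‖x‖ ^ 2) := by gcongr; linarith
      _ ≤ _ := by gcongr
  rw [h1]; linarith

/-- The zeroth-order term of `(1 - η M)²` disappears because `x ⊥ m`, so the pairing is of order
`η`. -/
theorem double_step_inner_le {M : E →L[ℝ] E} (hMn : ∀ x, ‖M x‖ ≤ 4 * ‖x‖) (hη : 0 ≤ η)
    {β : ℝ} {x m : E} (h0 : ⟪x, m⟫_ℝ = 0) (hMx : |⟪M x, m⟫_ℝ| ≤ β * (‖x‖ * ‖m‖)) :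
    |⟪(1 - η • M : E →L[ℝ] E) ((1 - η • M : E →L[ℝ] E) x), m⟫_ℝ|
      ≤ η * (2 * β + 16 * η) * (‖x‖ * ‖m‖) := by
  have h1 : ⟪(1 - η • M : E →L[ℝ] E) ((1 - η • M : E →L[ℝ] E) x), m⟫_ℝ
      = -(2 * η * ⟪M x, m⟫_ℝ) + η ^ 2 * ⟪M (M x), m⟫_ℝ := by
    have : (1 - η • M : E →L[ℝ] E) ((1 - η • M : E →L[ℝ] E) x)
        = x - (2 * η) • M x + η ^ 2 • M (M x) := by
      simp only [sub_apply, one_apply_eq_self, smul_apply, map_sub, map_smul]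
      module
    rw [this, inner_add_left, inner_sub_left, inner_smul_left, inner_smul_left, h0]
    simp only [conj_trivial]; ring
  have h2 : |⟪M (M x), m⟫_ℝ| ≤ 16 * (‖x‖ * ‖m‖) := by
    refine (abs_real_inner_le_norm _ _).trans ?_
    rw [← mul_assoc]
    gcongr
    linarith [hMn (M x), hMn x]
  rw [h1]
  refine (abs_add_le _ _).trans ?_
  rw [abs_neg, abs_mul, abs_mul (η ^ 2), abs_of_nonneg (by positivity : (0:ℝ) ≤ η ^ 2),
    abs_of_nonneg (by positivity : (0:ℝ) ≤ 2 * η)]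
  calc _ ≤ 2 * η * (β * (‖x‖ * ‖m‖)) + η ^ 2 * (16 * (‖x‖ * ‖m‖)) := by gcongr
    _ = _ := by ring

section FD
variable [FiniteDimensional ℝ E]

theorem noise_step (hG : IsGram G W) (hX : IsTarget X S₀ s) (hD : IsSmallSymm D ω)
    (hS : IsSplitting W S₀ S e σ τ) (he : 0 ≤ e) (hτ : 0 ≤ τ) (hω0 : 0 ≤ ω) (hω : ω ≤ 1 / 10)
    (hη : 0 ≤ η) (hη' : η ≤ 1 / 200) {k : E}
    (hk : k ∈ (S.map ((1 - η • (G - X + D) : E →L[ℝ] E) : E →ₗ[ℝ] E))ᗮ) :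
    ‖W ((1 - η • (G - X + D) : E →L[ℝ] E) k)‖ ≤ e * (1 + η * (τ ^ 2 + ω)) * ‖k‖ := by
  have hsymm := step_symm (residual_symm hG hX hD) η
  have hpos := step_inner_self_nonneg (residual_norm_le hG hX hD (by linarith)) hη (by linarith)
  have hk' := mem_orthogonal_map_step hsymm hk
  set A := (1 - η • (G - X + D) : E →L[ℝ] E) with hA
  refine (hS.noise _ hk').trans ?_
  rw [mul_assoc]
  gcongr
  set c := 1 + η * (τ ^ 2 + ω)
  have hc : 1 ≤ c := by
    have : 0 ≤ η * (τ ^ 2 + ω) := by positivity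
    simp only [c]; linarith
  set k' := A k with hk'def
  have h1 : ⟪k', A k'⟫_ℝ ≤ c * ‖k'‖ ^ 2 := by
    have h2 : ⟪k', A k'⟫_ℝ = ‖k'‖ ^ 2 - η * (‖W k'‖ ^ 2 - ⟪k', X k'⟫_ℝ + ⟪k', D k'⟫_ℝ) := by
      rw [← hG.inner_self, hG.symm]
      simp only [hA, sub_apply, one_apply_eq_self, smul_apply, add_apply,
        inner_sub_right, inner_smul_right, inner_add_right, real_inner_self_eq_norm_sq]
    have h3 : ⟪k', X k'⟫_ℝ ≤ τ ^ 2 * ‖k'‖ ^ 2 := by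
      rw [hX.nonneg]
      have h4 := hS.norm_starProjection_orthogonal_le hτ hk'
      calc _ ≤ ‖S₀.starProjection k'‖ * ‖X (S₀.starProjection k')‖ := real_inner_le_norm _ _
        _ ≤ ‖S₀.starProjection k'‖ * ‖S₀.starProjection k'‖ := by gcongr; exact hX.norm_le _
        _ ≤ (τ * ‖k'‖) * (τ * ‖k'‖) := by gcongr
        _ = _ := by ring
    have h5 : -(ω * ‖k'‖ ^ 2) ≤ ⟪k', D k'⟫_ℝ := by
      have := (abs_le.1 (abs_real_inner_le_norm k' (D k'))).1
      nlinarith [hD.norm_le k', norm_nonneg k']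
    have h6 : η * (-(τ ^ 2 + ω) * ‖k'‖ ^ 2) ≤ η * (‖W k'‖ ^ 2 - ⟪k', X k'⟫_ℝ + ⟪k', D k'⟫_ℝ) := by
      gcongr; nlinarith [sq_nonneg ‖W k'‖]
    rw [h2]; simp only [c]; nlinarith
  -- The form bound `h1` is available at `k' = A k ∈ Sᗮ` but not at `k`. Positivity of `A` at `k' -
  -- c k` transfers it: expanding gives `c ‖k'‖² ≤ c² ⟪k, k'⟫`.
  have h7 := hpos (k' - c • k)
  have h8 : ⟪k' - c • k, A (k' - c • k)⟫_ℝ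
      = ⟪k', A k'⟫_ℝ - 2 * c * ‖k'‖ ^ 2 + c ^ 2 * ⟪k, k'⟫_ℝ := by
    simp only [map_sub, map_smul, inner_sub_left, inner_sub_right, inner_smul_left,
      inner_smul_right, ← hk'def, ← hsymm k k', real_inner_self_eq_norm_sq]
    simp only [conj_trivial, ← hsymm]
    ring
  have h9 := real_inner_le_norm k k'
  rw [h8] at h7
  by_contra! hcon
  have h10 : 0 < ‖k'‖ := lt_of_le_of_lt (by positivity) hcon
  have h11 : ‖k'‖ ^ 2 ≤ c * (‖k‖ * ‖k'‖) := by
    have : 0 ≤ c * (c * (‖k‖ * ‖k'‖) - ‖k'‖ ^ 2) := by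
      have : c ^ 2 * ⟪k, k'⟫_ℝ ≤ c ^ 2 * (‖k‖ * ‖k'‖) := by gcongr
      nlinarith
    have := nonneg_of_mul_nonneg_right this (by linarith)
    linarith
  nlinarith

theorem norm_cross_le (hG : IsGram G W) (hn : ∀ k ∈ Sᗮ, ‖W k‖ ≤ e * ‖k‖) (he : 0 ≤ e) (x : E) :
    ‖G x - S.starProjection (G x)‖ ≤ e * ‖W x‖ := by
  apply norm_le_of_inner_self_le _ (by positivity)
  set n := G x - S.starProjection (G x) with hnd
  have hn' : n ∈ Sᗮ := S.sub_starProjection_mem_orthogonal _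
  have h1 : ⟪n, n⟫_ℝ = ⟪G x, n⟫_ℝ := by
    conv_lhs => rw [hnd, inner_sub_left]
    rw [S.inner_right_of_mem_orthogonal (S.starProjection_apply_mem _) hn', sub_zero]
  rw [h1]
  calc _ ≤ ‖W x‖ * ‖W n‖ := (le_abs_self _).trans (hG.inner_le _ _)
    _ ≤ ‖W x‖ * (e * ‖n‖) := by gcongr; exact hn _ hn'
    _ = _ := by ring

/-- Decomposition of one step on `S`: `A x = x' + η X x - η n` with `x' ∈ S`. -/
theorem step_decomp (hG : IsGram G W) (hD : IsSmallSymm D ω)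
    (hn : ∀ k ∈ Sᗮ, ‖W k‖ ≤ e * ‖k‖) (he : 0 ≤ e) (hη : 0 ≤ η) {x : E} (hx : x ∈ S) :
    ∃ x' ∈ S, ∃ n : E, x' = x - η • S.starProjection (G x) ∧
      (1 - η • (G - X + D) : E →L[ℝ] E) x = x' + η • X x - η • n ∧
      ‖n‖ ≤ (2 * e + ω) * ‖x‖ ∧ ‖x - x'‖ ≤ 2 * η * ‖x‖ := by
  refine ⟨x - η • S.starProjection (G x),
    S.sub_mem hx (S.smul_mem _ (S.starProjection_apply_mem _)),
    (G x - S.starProjection (G x)) + D x, rfl, ?_, ?_, ?_⟩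
  · simp only [sub_apply, one_apply_eq_self, smul_apply, add_apply]; module
  · refine (norm_add_le _ _).trans ?_
    have h1 := norm_cross_le hG hn he x
    have h2 := hG.norm_le x
    have h3 := hD.norm_le x
    nlinarith [norm_nonneg x]
  · rw [sub_sub_cancel, norm_smul, Real.norm_of_nonneg hη]
    have := (S.norm_starProjection_apply_le (G x)).trans (hG.norm_apply_le x)
    nlinarith

/-- In `A x = x' + η X x - η n` the vector `x' ∈ S` still has slope `τ`, and `X x` lies in `S₀`. So
the component along `S₀` is stretched by about `1 + η s`, while the component off `S₀` changes only
through the small vector `n`. -/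
theorem tilt_step (hG : IsGram G W) (hX : IsTarget X S₀ s) (hD : IsSmallSymm D ω)
    (hS : IsSplitting W S₀ S e σ τ) (hs : 0 < s) (hs1 : s ≤ 1) (he : 0 ≤ e) (hτ : 0 ≤ τ)
    (hω0 : 0 ≤ ω) (hη : 0 ≤ η) (hη' : η ≤ s / 200) (hτ' : τ ≤ 1 / 100)
    (hρ : 2 * e + ω ≤ s / 100) {y : E}
    (hy : y ∈ (S.map ((1 - η • (G - X + D) : E →L[ℝ] E) : E →ₗ[ℝ] E))) :
    ‖y - S₀.starProjection y‖
      ≤ ((1 - η * s / 2) * τ + 3 * η * (2 * e + ω)) * ‖S₀.starProjection y‖ := by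
  obtain ⟨x, hx, rfl⟩ := hy
  obtain ⟨x', hx', n, -, hAx, hn, hxx'⟩ := step_decomp (X := X) hG hD hS.noise he hη hx
  have htilt := hS.tilt x' hx'
  set ρ := 2 * e + ω with hρd
  have hρ0 : 0 ≤ ρ := by positivity
  set V := S₀.starProjection with hV
  simp only [ContinuousLinearMap.coe_coe]
  rw [hAx]
  have hVX : ∀ z, V (X z) = X z := fun z => S₀.starProjection_eq_self_iff.2 (hX.mem z)
  have hXV : ∀ z, X (V z) = X z := hX.apply_starProjection
  have e1 : x' + η • X x - η • n - V (x' + η • X x - η • n)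
      = (x' - V x') - η • (n - V n) := by
    simp only [map_add, map_sub, map_smul, hVX]; module
  have e2 : V (x' + η • X x - η • n)
      = (V x' + η • X (V x')) + η • X (x - x') - η • V n := by
    simp only [map_add, map_sub, map_smul, hVX, hXV]; module
  have b1 : ‖V n‖ ≤ ρ * ‖x‖ := (S₀.norm_starProjection_apply_le n).trans hn
  have b2 : ‖n - V n‖ ≤ ρ * ‖x‖ := (sub_starProjection_norm_le S₀ n).trans hn
  have b3 : ‖X (x - x')‖ ≤ 2 * η * ‖x‖ := (hX.norm_le _).trans hxx'
  set v := ‖V x'‖ with hv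
  have hv0 : 0 ≤ v := norm_nonneg _
  have b4 : (1 + η * s) * v ≤ ‖V x' + η • X (V x')‖ := by
    have h1 := hX.lower (V x') (S₀.starProjection_apply_mem _)
    have h2 := real_inner_le_norm (V x') (V x' + η • X (V x'))
    rw [inner_add_right, inner_smul_right, real_inner_self_eq_norm_sq] at h2
    by_contra! hc
    have h3 : 0 < v := by
      by_contra! h
      have : v = 0 := le_antisymm h hv0
      rw [this, mul_zero] at hc
      exact absurd hc (not_lt.2 (norm_nonneg _))
    have h4 : η * (s * ‖V x'‖ ^ 2) ≤ η * ⟪V x', X (V x')⟫_ℝ := by gcongr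
    have h5 : v * ‖V x' + η • X (V x')‖ < v * ((1 + η * s) * v) := by gcongr
    nlinarith
  have b5 : ‖x‖ ≤ 6 / 5 * v := by
    have h1 : ‖x‖ ≤ ‖x'‖ + ‖x - x'‖ := by
      have : x = x' + (x - x') := by abel
      exact (congrArg norm this).le.trans (norm_add_le _ _)
    have h2 : ‖x'‖ ≤ ‖V x'‖ + ‖x' - V x'‖ := by
      have : x' = V x' + (x' - V x') := by abel
      exact (congrArg norm this).le.trans (norm_add_le _ _)
    have h3 : τ * v ≤ 1 / 100 * v := by gcongr
    have h4 : 2 * η * ‖x‖ ≤ 1 / 100 * ‖x‖ := by gcongr; linarith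
    linarith
  have up : ‖x' + η • X x - η • n - V (x' + η • X x - η • n)‖ ≤ (τ + 6 / 5 * η * ρ) * v := by
    rw [e1]
    refine (norm_sub_le _ _).trans ?_
    rw [norm_smul, Real.norm_of_nonneg hη]
    have : η * ‖n - V n‖ ≤ η * (ρ * (6 / 5 * v)) := by
      gcongr; exact b2.trans (by gcongr)
    linarith
  have low : (1 + 9 / 10 * (η * s)) * v ≤ ‖V (x' + η • X x - η • n)‖ := by
    rw [e2]
    have h1 : ‖V x' + η • X (V x')‖ ≤ ‖(V x' + η • X (V x')) + η • X (x - x') - η • V n‖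
        + η * ‖X (x - x')‖ + η * ‖V n‖ := by
      have h2 : V x' + η • X (V x') = ((V x' + η • X (V x')) + η • X (x - x') - η • V n)
        - η • X (x - x') + η • V n := by abel
      conv_lhs => rw [h2]
      refine (norm_add_le _ _).trans ?_
      rw [norm_smul η (V n), Real.norm_of_nonneg hη]
      gcongr
      refine (norm_sub_le _ _).trans ?_
      rw [norm_smul η (X (x - x')), Real.norm_of_nonneg hη]
    have h3 : η * ‖X (x - x')‖ ≤ η * (2 * (s / 200) * (6 / 5 * v)) := by
      gcongr; exact b3.trans (by gcongr)
    have h4 : η * ‖V n‖ ≤ η * (s / 100 * (6 / 5 * v)) := by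
      gcongr; exact b1.trans (by gcongr)
    have : 0 ≤ η * s * v := by positivity
    nlinarith
  refine up.trans ?_
  have hηs : 0 ≤ η * s := by positivity
  have hηs1 : η * s ≤ 1 / 200 := by nlinarith
  have hK : 0 ≤ (1 - η * s / 2) * τ + 3 * η * ρ := by
    have : 0 ≤ 1 - η * s / 2 := by linarith
    positivity
  calc (τ + 6 / 5 * η * ρ) * v
      ≤ ((1 - η * s / 2) * τ + 3 * η * ρ) * ((1 + 9 / 10 * (η * s)) * v) := by
        rw [← mul_assoc]; gcongr
        have h1 : 0 ≤ τ * (η * s * (4 / 10 - 9 / 20 * (η * s))) := by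
          apply mul_nonneg hτ (mul_nonneg hηs (by linarith))
        have h2 : 0 ≤ η * ρ := by positivity
        have h3 : 0 ≤ η * ρ * (η * s) := by positivity
        nlinarith
    _ ≤ _ := by gcongr

theorem IsSplitting.exists_compression_eq (hG : IsGram G W) (hS : IsSplitting W S₀ S e σ τ)
    (hσ : 0 < σ) {x : E} (hx : x ∈ S) : ∃ u ∈ S, S.starProjection (G u) = x := by
  let f : S →ₗ[ℝ] S := S.orthogonalProjectionOnto.toLinearMap ∘ₗ G.toLinearMap ∘ₗ S.subtype
  have hf : ∀ u : S, (f u : E) = S.starProjection (G (u : E)) := fun u => rfl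
  have hinj : Function.Injective f := by
    rw [injective_iff_map_eq_zero]
    intro u hu
    have h1 : S.starProjection (G (u : E)) = 0 := by rw [← hf, hu]; rfl
    have h2 : ⟪S.starProjection (G (u : E)), (u : E)⟫_ℝ = ‖W u‖ ^ 2 := by
      rw [← hG.inner_self]
      have := S.starProjection_inner_eq_zero (G (u : E)) _ u.2
      rw [inner_sub_left] at this; linarith
    rw [h1, inner_zero_left] at h2
    have h3 := hS.signal u u.2
    have h4 : ‖W (u : E)‖ = 0 := by
      have := h2.symm; exact pow_eq_zero_iff (two_ne_zero) |>.1 this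
    rw [h4] at h3
    have : ‖(u : E)‖ = 0 := by
      have := norm_nonneg (u : E)
      by_contra h
      have : 0 < ‖(u : E)‖ := lt_of_le_of_ne this (Ne.symm h)
      nlinarith
    exact Subtype.ext (norm_eq_zero.1 this)
  obtain ⟨u, hu⟩ := LinearMap.surjective_of_injective hinj ⟨x, hx⟩
  exact ⟨u, u.2, by rw [← hf, hu]⟩

/-- On an eigenvector of the compression of `G` to `S` with eigenvalue `l`, the claim is `l (1 - η
l)² ≥ σ² (1 - 2 η σ²)`. This holds because the left side increases in `l` on `[σ², 2]`. The proof
avoids diagonalisation by expanding around `l = σ²` through `z = x - σ² u`. -/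
theorem compression_contract_ge (hG : IsGram G W) (hS : IsSplitting W S₀ S e σ τ) (hη : 0 ≤ η)
    (hη1 : η ≤ 1 / 200) (hσ : 0 < σ) (hσ1 : σ ^ 2 ≤ 1 / 20) {x u : E} (hx : x ∈ S) (huS : u ∈ S)
    (hu : S.starProjection (G u) = x) :
    σ ^ 2 * (1 - 2 * η * σ ^ 2) * ‖W u‖ ^ 2 ≤ ‖x - η • S.starProjection (G x)‖ ^ 2 := by
  set P := S.starProjection with hP
  have hPin : ∀ a : E, ∀ b ∈ S, ⟪P a, b⟫_ℝ = ⟪a, b⟫_ℝ := fun a b hb => by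
    have := S.starProjection_inner_eq_zero a b hb
    rw [inner_sub_left] at this; linarith
  have hxu : ⟪x, u⟫_ℝ = ‖W u‖ ^ 2 := by rw [← hu, hPin _ _ huS, hG.inner_self]
  set b := ‖W u‖ with hb
  set z := x - σ ^ 2 • u with hz
  have hzS : z ∈ S := S.sub_mem hx (S.smul_mem _ huS)
  have hPGx : P (G x) = P (G z) + σ ^ 2 • x := by
    rw [hz, map_sub, map_sub, map_smul, map_smul, hu]; abel
  have q1 : 0 ≤ ⟪u, z⟫_ℝ := by
    rw [hz, inner_sub_right, inner_smul_right, real_inner_comm, hxu, real_inner_self_eq_norm_sq]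
    have := hS.signal u huS
    have h2 : (σ * ‖u‖) ^ 2 ≤ b ^ 2 := by gcongr
    nlinarith
  have q2 : ⟪x, x⟫_ℝ = ‖z‖ ^ 2 + 2 * σ ^ 2 * ⟪u, z⟫_ℝ + σ ^ 4 * ‖u‖ ^ 2 := by
    have : x = z + σ ^ 2 • u := by rw [hz]; abel
    rw [this, real_inner_self_eq_norm_sq, norm_add_sq_real, inner_smul_right, norm_smul,
      Real.norm_of_nonneg (by positivity), real_inner_comm]; ring
  have q3 : b ^ 2 = ⟪u, z⟫_ℝ + σ ^ 2 * ‖u‖ ^ 2 := by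
    rw [← hxu, real_inner_comm, hz, inner_sub_right, inner_smul_right,
      real_inner_self_eq_norm_sq]; ring
  have q4 : ⟪x, P (G x)⟫_ℝ = ‖W z‖ ^ 2 + 2 * σ ^ 2 * ‖z‖ ^ 2 + 3 * σ ^ 4 * ⟪u, z⟫_ℝ
      + σ ^ 6 * ‖u‖ ^ 2 := by
    have t1 : ⟪x, P (G z)⟫_ℝ = ‖W z‖ ^ 2 + σ ^ 2 * ⟪x, z⟫_ℝ := by
      rw [real_inner_comm, hPin _ _ hx, hG.symm, real_inner_comm, ← hPin _ _ hzS, hPGx,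
        inner_add_left, hPin _ _ hzS, hG.inner_self, inner_smul_left]; rfl
    have t2 : ⟪x, z⟫_ℝ = ‖z‖ ^ 2 + σ ^ 2 * ⟪u, z⟫_ℝ := by
      have : x = z + σ ^ 2 • u := by rw [hz]; abel
      conv_lhs => rw [this]
      rw [inner_add_left, inner_smul_left, real_inner_self_eq_norm_sq]; rfl
    rw [hPGx, inner_add_right, inner_smul_right, t1, t2, q2]; ring
  have q5 : ‖x - η • P (G x)‖ ^ 2 = ⟪x, x⟫_ℝ - 2 * η * ⟪x, P (G x)⟫_ℝ + η ^ 2 * ‖P (G x)‖ ^ 2 := by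
    rw [norm_sub_sq_real, inner_smul_right, norm_smul, mul_pow, real_inner_self_eq_norm_sq,
      Real.norm_of_nonneg hη]; ring
  have q6 := hG.sq_le z
  rw [q5, q4, q2, q3]
  have w1 : η * ‖W z‖ ^ 2 ≤ η * (2 * ‖z‖ ^ 2) := by gcongr
  have w2 : η * (σ ^ 2 * ‖z‖ ^ 2) ≤ η * (1 / 20 * ‖z‖ ^ 2) := by gcongr
  have w3 : η * ‖z‖ ^ 2 ≤ 1 / 200 * ‖z‖ ^ 2 := by gcongr
  have w4 : η * σ ^ 2 ≤ 1 / 200 * (1 / 20) := by gcongr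
  have w5 : η * σ ^ 2 * (σ ^ 2 * ⟪u, z⟫_ℝ) ≤ 1 / 200 * (1 / 20) * (σ ^ 2 * ⟪u, z⟫_ℝ) := by gcongr
  have w6 : 0 ≤ σ ^ 2 * ⟪u, z⟫_ℝ := by positivity
  have w7 : 0 ≤ η ^ 2 * ‖P (G x)‖ ^ 2 := by positivity
  have w8 : 0 ≤ η * σ ^ 2 * σ ^ 2 * ⟪u, z⟫_ℝ := by positivity
  nlinarith [sq_nonneg ‖z‖]

/-- `x'` is within relative distance `1/100` of `S₀`, where `X` is at least `s`, so pairing with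
`x'` yields a gain of `0.99 η s`; the errors from `n` and `x - x'` consume less than `0.29 η s`. -/
theorem step_growth (hX : IsTarget X S₀ s) (hS : IsSplitting W S₀ S e σ τ) (hs : 0 < s)
    (hτ : 0 ≤ τ) (hη : 0 ≤ η) (hη' : η ≤ s / 200) (hτ' : τ ≤ 1 / 100) {ρ : ℝ}
    (hρ : ρ ≤ s / 100) {x x' n a : E} (hx' : x' ∈ S)
    (hAx : a = x' + η • X x - η • n) (hn : ‖n‖ ≤ ρ * ‖x‖) (hxx' : ‖x - x'‖ ≤ 2 * η * ‖x‖)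
    (hxx : ‖x‖ ≤ 51 / 50 * ‖x'‖) : (1 + 7 / 10 * (η * s)) * ‖x'‖ ≤ ‖a‖ := by
  have h1 : ‖x'‖ ^ 2 + η * (99 / 100 * s * ‖x'‖ ^ 2) ≤ ⟪x', x' + η • X x'⟫_ℝ := by
    rw [inner_add_right, inner_smul_right, real_inner_self_eq_norm_sq, hX.nonneg]
    have h2 := hX.lower _ (S₀.starProjection_apply_mem x')
    have h3 := hS.norm_proj_sub_le hτ hx'
    have h4 : ‖x'‖ ≤ ‖S₀.starProjection x'‖ + ‖x' - S₀.starProjection x'‖ := by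
      have : x' = S₀.starProjection x' + (x' - S₀.starProjection x') := by abel
      exact (congrArg norm this).le.trans (norm_add_le _ _)
    have h5 := S₀.norm_starProjection_apply_le x'
    have h7 : ‖S₀.starProjection x'‖ ^ 2 ≥ 99 / 100 * ‖x'‖ ^ 2 := by
      have h8 := S₀.norm_sq_eq_add_norm_sq_starProjection x'
      rw [S₀.starProjection_orthogonal_val] at h8
      have h9 : τ * ‖x'‖ ≤ 1 / 100 * ‖x'‖ := by gcongr
      have h10 : ‖x' - S₀.starProjection x'‖ ^ 2 ≤ (1 / 100 * ‖x'‖) ^ 2 := by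
        gcongr; linarith
      nlinarith [sq_nonneg ‖x'‖]
    have : η * (99 / 100 * s * ‖x'‖ ^ 2) ≤
        η * ⟪S₀.starProjection x', X (S₀.starProjection x')⟫_ℝ := by
      gcongr
      nlinarith
    linarith
  have h2 : ⟪x', x' + η • X x'⟫_ℝ ≤ ‖x'‖ * ‖x' + η • X x'‖ := real_inner_le_norm _ _
  have h3 : ‖x' + η • X x'‖ ≤ ‖a‖ + η * ‖X (x - x')‖ + η * ‖n‖ := by
    have h4 : x' + η • X x' = a - η • X (x - x') + η • n := by
      rw [hAx, map_sub]; module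
    rw [h4]
    refine (norm_add_le _ _).trans ?_
    rw [norm_smul η n, Real.norm_of_nonneg hη]
    gcongr
    refine (norm_sub_le _ _).trans ?_
    rw [norm_smul, Real.norm_of_nonneg hη]
  have h5 : η * ‖X (x - x')‖ ≤ η * (2 * (s / 200) * (51 / 50 * ‖x'‖)) := by
    gcongr; exact (hX.norm_le _).trans (hxx'.trans (by gcongr))
  have h6 : η * ‖n‖ ≤ η * (s / 100 * (51 / 50 * ‖x'‖)) := by
    gcongr; exact hn.trans (by gcongr)
  have h7 : (1 + 99 / 100 * (η * s)) * ‖x'‖ ≤ ‖x' + η • X x'‖ := by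
    by_contra! hc
    have h8 : 0 < ‖x'‖ := by
      by_contra! h
      have : ‖x'‖ = 0 := le_antisymm h (norm_nonneg _)
      rw [this, mul_zero] at hc
      exact absurd hc (not_lt.2 (norm_nonneg _))
    have h5 : ‖x'‖ * ‖x' + η • X x'‖ < ‖x'‖ * ((1 + 99 / 100 * (η * s)) * ‖x'‖) := by gcongr
    nlinarith
  have : 0 ≤ η * s * ‖x'‖ := by positivity
  nlinarith

theorem residual_cross_le (hG : IsGram G W) (hX : IsTarget X S₀ s) (hD : IsSmallSymm D ω)
    (hS : IsSplitting W S₀ S e σ τ) (he : 0 ≤ e) (hτ : 0 ≤ τ) {x m : E} (hmS : m ∈ Sᗮ) :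
    |⟪(G - X + D) x, m⟫_ℝ| ≤ (2 * e + τ + ω) * (‖x‖ * ‖m‖) := by
  have h1 : |⟪G x, m⟫_ℝ| ≤ 2 * e * ‖x‖ * ‖m‖ := by
    calc _ ≤ ‖W x‖ * ‖W m‖ := hG.inner_le _ _
      _ ≤ (3 / 2 * ‖x‖) * (e * ‖m‖) := by gcongr; exacts [hG.norm_le x, hS.noise m hmS]
      _ ≤ 2 * ‖x‖ * (e * ‖m‖) := by gcongr; norm_num
      _ = _ := by ring
  have h2 : |⟪X x, m⟫_ℝ| ≤ τ * ‖x‖ * ‖m‖ := by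
    have h3 : ⟪X x, m⟫_ℝ = ⟪X x, S₀.starProjection m⟫_ℝ := by
      have := S₀.starProjection_inner_eq_zero m _ (hX.mem x)
      rw [inner_sub_left, real_inner_comm, real_inner_comm (X x) (S₀.starProjection m)] at this
      linarith
    rw [h3]
    calc _ ≤ ‖X x‖ * ‖S₀.starProjection m‖ := abs_real_inner_le_norm _ _
      _ ≤ ‖x‖ * (τ * ‖m‖) := by
        gcongr; exacts [hX.norm_le x, hS.norm_starProjection_orthogonal_le hτ hmS]
      _ = _ := by ring
  have h4 : |⟪D x, m⟫_ℝ| ≤ ω * ‖x‖ * ‖m‖ :=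
    (abs_real_inner_le_norm _ _).trans (by gcongr; exact hD.norm_le x)
  have h5 : ⟪(G - X + D) x, m⟫_ℝ = ⟪G x, m⟫_ℝ - ⟪X x, m⟫_ℝ + ⟪D x, m⟫_ℝ := by
    simp only [add_apply, sub_apply, inner_add_left, inner_sub_left]
  rw [h5]
  refine (abs_add_le _ _).trans ?_
  have := abs_sub (⟪G x, m⟫_ℝ) ⟪X x, m⟫_ℝ
  linarith

/-- A lower bound for `W (A (A x))` comes from pairing with `W u`, where `u ∈ S` solves `P (G u) =
x`. Since `G u = x + m` with `m ∈ Sᗮ`, the pairing is `‖A x‖² + ⟪A (A x), m⟫`. The first term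
carries the growth: the loss `2 η σ²` from the compression of `G` is at most `η s / 10`, against a
gain of `7 η s / 10`. -/
theorem signal_step (hG : IsGram G W) (hX : IsTarget X S₀ s) (hD : IsSmallSymm D ω)
    (hS : IsSplitting W S₀ S e σ τ) (hs : 0 < s) (hs1 : s ≤ 1) (he : 0 ≤ e) (hτ : 0 ≤ τ)
    (hω0 : 0 ≤ ω) (hη : 0 ≤ η) (hη' : η ≤ s / 200) (hτ' : τ ≤ s / 100)
    (hβ : 2 * e + τ + ω ≤ s / 100) (hσ : 0 < σ) (hσ' : σ ^ 2 ≤ s / 20) (heσ : e ≤ σ) {y : E}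
    (hy : y ∈ (S.map ((1 - η • (G - X + D) : E →L[ℝ] E) : E →ₗ[ℝ] E))) :
    σ * (1 + η * s / 10) * ‖y‖ ≤ ‖W ((1 - η • (G - X + D) : E →L[ℝ] E) y)‖ := by
  have hsymm := step_symm (residual_symm hG hX hD) η
  have hMn := residual_norm_le hG hX hD (by linarith)
  have hMs := residual_symm hG hX hD
  obtain ⟨x, hx, rfl⟩ := hy
  obtain ⟨x', hx', n, hx'd, hAx, hn, hxx'⟩ := step_decomp (X := X) hG hD hS.noise he hη hx
  simp only [ContinuousLinearMap.coe_coe]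
  set M := G - X + D with hM
  set A := (1 - η • M : E →L[ℝ] E) with hA
  set P := S.starProjection with hP
  have hu := hS.exists_compression_eq hG hσ hx
  obtain ⟨u, huS, hu⟩ := hu
  have hPin : ∀ a : E, ∀ b ∈ S, ⟪P a, b⟫_ℝ = ⟪a, b⟫_ℝ := fun a b hb => by
    have := S.starProjection_inner_eq_zero a b hb
    rw [inner_sub_left] at this; linarith
  have hxu : ⟪x, u⟫_ℝ = ‖W u‖ ^ 2 := by rw [← hu, hPin _ _ huS, hG.inner_self]
  set b := ‖W u‖ with hb
  have hb0 : 0 ≤ b := norm_nonneg _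
  have hx'2 : σ ^ 2 * (1 - 2 * η * σ ^ 2) * b ^ 2 ≤ ‖x'‖ ^ 2 := by
    rw [hx'd]; exact compression_contract_ge hG hS hη (by linarith) hσ (by linarith) hx huS hu
  have hηs : 0 ≤ η * s := by positivity
  have hηs1 : η * s ≤ 1 / 200 := by nlinarith
  have hx'1 : σ * (1 - η * s / 10) * b ≤ ‖x'‖ := by
    apply abs_le_of_sq_le_sq' _ (norm_nonneg _) |>.2
    refine le_trans ?_ hx'2
    have h1 : η * σ ^ 2 ≤ η * (s / 20) := by gcongr
    have h2 : (1 - η * s / 10) ^ 2 ≤ 1 - 2 * η * σ ^ 2 := by nlinarith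
    calc _ = σ ^ 2 * (1 - η * s / 10) ^ 2 * b ^ 2 := by ring
      _ ≤ _ := by gcongr
  -- lower bound for `A x`
  set ρ := 2 * e + ω with hρ
  have hρ0 : 0 ≤ ρ := by positivity
  have hxx : ‖x‖ ≤ 51 / 50 * ‖x'‖ := by
    have h1 : ‖x‖ ≤ ‖x'‖ + ‖x - x'‖ := by
      have : x = x' + (x - x') := by abel
      exact (congrArg norm this).le.trans (norm_add_le _ _)
    have h4 : 2 * η * ‖x‖ ≤ 1 / 100 * ‖x‖ := by gcongr; linarith
    linarith [norm_nonneg x']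
  have hy1 : (1 + 7 / 10 * (η * s)) * ‖x'‖ ≤ ‖A x‖ :=
    step_growth hX hS hs hτ hη hη' (by linarith) (by linarith) hx' hAx hn hxx' hxx
  have hy2 : σ * (1 + η * s * (1 / 2)) * b ≤ ‖A x‖ := by
    refine le_trans ?_ ((mul_le_mul_of_nonneg_left hx'1 (by positivity)).trans hy1)
    have : (1 + η * s * (1 / 2)) ≤ (1 + 7 / 10 * (η * s)) * (1 - η * s / 10) := by nlinarith
    calc _ = (1 + η * s * (1 / 2)) * (σ * b) := by ring
      _ ≤ (1 + 7 / 10 * (η * s)) * (1 - η * s / 10) * (σ * b) := by gcongr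
      _ = _ := by ring
  have hxy : ‖x‖ ≤ 21 / 20 * ‖A x‖ := by
    have : ‖x'‖ ≤ ‖A x‖ := by nlinarith [norm_nonneg x', mul_nonneg hηs (norm_nonneg x')]
    linarith [norm_nonneg (A x)]
  -- pairing with `W u`
  set m := G u - P (G u) with hm
  have hmS : m ∈ Sᗮ := S.sub_starProjection_mem_orthogonal _
  have hmn : ‖m‖ ≤ e * b := norm_cross_le hG hS.noise he u
  have hAm : |⟪A (A x), m⟫_ℝ| ≤ η * s * (2 / 5) * (‖A x‖ * (e * b)) := by
    have h0 : ⟪x, m⟫_ℝ = 0 := S.inner_right_of_mem_orthogonal hx hmS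
    refine (double_step_inner_le hMn hη h0 (residual_cross_le hG hX hD hS he hτ hmS)).trans ?_
    calc η * (2 * (2 * e + τ + ω) + 16 * η) * (‖x‖ * ‖m‖)
        ≤ η * (2 * (s / 100) + 16 * (s / 200)) * ((21 / 20 * ‖A x‖) * (e * b)) := by gcongr
      _ = η * s * (21 / 200) * (‖A x‖ * (e * b)) := by ring
      _ ≤ _ := by
        have : 0 ≤ η * s * (‖A x‖ * (e * b)) := by positivity
        linarith
  have hpair : ‖A x‖ ^ 2 - η * s * (2 / 5) * (‖A x‖ * (e * b)) ≤ ‖W (A (A x))‖ * b := by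
    have h1 : ⟪W (A (A x)), W u⟫_ℝ = ‖A x‖ ^ 2 + ⟪A (A x), m⟫_ℝ := by
      rw [← hG.inner_eq, hG.symm]
      have : G u = x + m := by rw [hm, hu]; abel
      rw [this, inner_add_right, hsymm (A x) x, real_inner_self_eq_norm_sq]
    have h2 := real_inner_le_norm (W (A (A x))) (W u)
    rw [h1] at h2
    linarith [(abs_le.1 hAm).1]
  rcases hb0.eq_or_lt with hb1 | hb1
  · have h1 : x = 0 := by
      have h2 := hS.signal u huS
      rw [← hb, ← hb1] at h2
      have h3 : ‖u‖ = 0 := by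
        by_contra h
        have : 0 < ‖u‖ := lt_of_le_of_ne (norm_nonneg _) (Ne.symm h)
        nlinarith
      rw [← hu, norm_eq_zero.1 h3]; simp
    rw [h1]; simp
  · have h1 : σ * (1 + η * s / 10) * ‖A x‖ * b ≤ ‖W (A (A x))‖ * b := by
      refine le_trans ?_ hpair
      have h2 : ‖A x‖ * (σ * (1 + η * s * (1 / 2)) * b) ≤ ‖A x‖ * ‖A x‖ := by gcongr
      have h3 : η * s * (2 / 5) * (‖A x‖ * (e * b)) ≤ η * s * (2 / 5) * (‖A x‖ * (σ * b)) := by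
        gcongr
      calc _ = ‖A x‖ * (σ * (1 + η * s * (1 / 2)) * b)
            - η * s * (2 / 5) * (‖A x‖ * (σ * b)) := by ring
        _ ≤ _ := by rw [sq]; linarith
    exact le_of_mul_le_mul_right h1 hb1

end FD

end

/-! ### Contraction of the residual `G - X`. -/

section

variable {E : Type*} [NormedAddCommGroup E] [InnerProductSpace ℝ E]
variable {G W X D : E →L[ℝ] E} {S₀ S : Submodule ℝ E} {s ω e σ τ η ψ : ℝ}

theorem IsGram.norm_apply_le_norm (hG : IsGram G W) (z : E) : ‖G z‖ ≤ √2 * ‖W z‖ := by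
  apply norm_le_of_inner_self_le _ (by positivity)
  calc _ ≤ ‖W z‖ * ‖W (G z)‖ := (le_abs_self _).trans (hG.inner_le z (G z))
    _ ≤ ‖W z‖ * (√2 * ‖G z‖) := by gcongr; exact hG.norm_le' _
    _ = _ := by ring

theorem IsGram.norm_apply_sq_le (hG : IsGram G W) (z : E) : ‖G z‖ ^ 2 ≤ 2 * ‖W z‖ ^ 2 := by
  have h := hG.norm_apply_le_norm z
  calc ‖G z‖ ^ 2 ≤ (√2 * ‖W z‖) ^ 2 := by gcongr
    _ = _ := by rw [mul_pow, Real.sq_sqrt (by norm_num)]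

theorem IsGram.contract_norm_le (hG : IsGram G W) (hη : 0 ≤ η) (hη' : η ≤ 1) (z : E) :
    ‖z - η • G z‖ ≤ ‖z‖ := by
  apply abs_le_of_sq_le_sq' _ (norm_nonneg _) |>.2
  rw [norm_sub_sq_real, inner_smul_right, ← hG.symm, hG.inner_self, norm_smul, mul_pow,
    Real.norm_of_nonneg hη]
  have h1 : η ^ 2 * ‖G z‖ ^ 2 ≤ η ^ 2 * (2 * ‖W z‖ ^ 2) := by gcongr; exact hG.norm_apply_sq_le z
  have h2 : η ^ 2 * (2 * ‖W z‖ ^ 2) ≤ η * (2 * ‖W z‖ ^ 2) := by gcongr; nlinarith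
  linarith

theorem norm_compress_orthogonal_le [S.HasOrthogonalProjection] (hG : IsGram G W)
    (hn : ∀ k ∈ Sᗮ, ‖W k‖ ≤ e * ‖k‖) (he : 0 ≤ e) (z : E) :
    ‖Sᗮ.starProjection (G (Sᗮ.starProjection z))‖ ≤ e ^ 2 * ‖z‖ := by
  apply norm_le_of_inner_self_le _ (by positivity)
  set k := Sᗮ.starProjection z
  set n := Sᗮ.starProjection (G k) with hnd
  have hk : k ∈ Sᗮ := Sᗮ.starProjection_apply_mem _
  have hn' : n ∈ Sᗮ := Sᗮ.starProjection_apply_mem _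
  have h1 : ⟪n, n⟫_ℝ = ⟪G k, n⟫_ℝ := by
    have := Sᗮ.starProjection_inner_eq_zero (G k) n hn'
    rw [inner_sub_left] at this; linarith
  rw [h1]
  calc _ ≤ ‖W k‖ * ‖W n‖ := (le_abs_self _).trans (hG.inner_le _ _)
    _ ≤ (e * ‖k‖) * (e * ‖n‖) := by gcongr; exacts [hn _ hk, hn _ hn']
    _ ≤ (e * ‖z‖) * (e * ‖n‖) := by gcongr; exact Sᗮ.norm_starProjection_apply_le z
    _ = _ := by ring

section FD
variable [FiniteDimensional ℝ E]

theorem IsSplitting.norm_starProjection_le_of_orthogonal (hS : IsSplitting W S₀ S e σ τ)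
    (hτ : 0 ≤ τ) {k : E} (hk : k ∈ S₀ᗮ) : ‖S.starProjection k‖ ≤ τ * ‖k‖ := by
  apply norm_le_of_inner_self_le _ (by positivity)
  set y := S.starProjection k with hy
  have hyS : y ∈ S := S.starProjection_apply_mem _
  have h1 : ⟪y, y⟫_ℝ = ⟪y - S₀.starProjection y, k⟫_ℝ := by
    have h2 := S.starProjection_inner_eq_zero k y hyS
    rw [inner_sub_left] at h2
    rw [inner_sub_left, S₀.inner_right_of_mem_orthogonal (S₀.starProjection_apply_mem _) hk,
      real_inner_comm k y]
    linarith
  rw [h1]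
  calc _ ≤ _ := real_inner_le_norm _ _
    _ ≤ (τ * ‖y‖) * ‖k‖ := by gcongr; exact hS.norm_proj_sub_le hτ hyS
    _ = _ := by ring

theorem IsSplitting.norm_sub_starProjection_le_of_mem (hS : IsSplitting W S₀ S e σ τ)
    (hτ : 0 ≤ τ) {v : E} (hv : v ∈ S₀) : ‖v - S.starProjection v‖ ≤ τ * ‖v‖ := by
  apply norm_le_of_inner_self_le _ (by positivity)
  set k := v - S.starProjection v with hk
  have hkS : k ∈ Sᗮ := S.sub_starProjection_mem_orthogonal _
  have h1 : ⟪k, k⟫_ℝ = ⟪S₀.starProjection k, v⟫_ℝ := by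
    have h2 := S₀.starProjection_inner_eq_zero k v hv
    have h3 := S.inner_right_of_mem_orthogonal (S.starProjection_apply_mem v) hkS
    rw [inner_sub_left] at h2
    have h4 : ⟪k, k⟫_ℝ = ⟪k, v⟫_ℝ - ⟪k, S.starProjection v⟫_ℝ := by rw [← inner_sub_right]
    rw [real_inner_comm] at h3
    linarith
  rw [h1]
  calc _ ≤ _ := real_inner_le_norm _ _
    _ ≤ (τ * ‖k‖) * ‖v‖ := by gcongr; exact hS.norm_starProjection_orthogonal_le hτ hkS
    _ = _ := by ring

theorem IsSplitting.norm_apply_le_of_orthogonal (hG : IsGram G W)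
    (hS : IsSplitting W S₀ S e σ τ) (he : 0 ≤ e) (hτ : 0 ≤ τ) {k : E} (hk : k ∈ S₀ᗮ) :
    ‖W k‖ ≤ (√2 * τ + e) * ‖k‖ := by
  have h1 : W k = W (S.starProjection k) + W (k - S.starProjection k) := by
    rw [← map_add]; congr 1; abel
  rw [h1, add_mul]
  refine (norm_add_le _ _).trans ?_
  gcongr
  · rw [mul_assoc]
    exact (hG.norm_le' _).trans (by gcongr; exact hS.norm_starProjection_le_of_orthogonal hτ hk)
  · exact (hS.noise _ (S.sub_starProjection_mem_orthogonal k)).trans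
      (by gcongr; exact sub_starProjection_norm_le S k)

theorem IsSplitting.le_norm_apply_of_mem (hS : IsSplitting W S₀ S e σ τ) (hτ : 0 ≤ τ)
    (hτ' : τ ≤ 1 / 100) (hσ : 0 < σ) (heσ : e ≤ σ) {v : E} (hv : v ∈ S₀) :
    9 / 10 * σ * ‖v‖ ≤ ‖W v‖ := by
  have h1 : W (S.starProjection v) = W v - W (v - S.starProjection v) := by
    rw [← map_sub]; congr 1; abel
  have h2 := hS.signal _ (S.starProjection_apply_mem v)
  have h3 := hS.noise _ (S.sub_starProjection_mem_orthogonal v)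
  have h4 := hS.norm_sub_starProjection_le_of_mem hτ hv
  have h5 : ‖W (S.starProjection v)‖ ≤ ‖W v‖ + ‖W (v - S.starProjection v)‖ := by
    rw [h1]; exact norm_sub_le _ _
  have h6 : ‖v‖ ≤ ‖S.starProjection v‖ + ‖v - S.starProjection v‖ := by
    have : v = S.starProjection v + (v - S.starProjection v) := by abel
    exact (congrArg norm this).le.trans (norm_add_le _ _)
  have h7 : ‖v - S.starProjection v‖ ≤ 1 / 100 * ‖v‖ := h4.trans (by gcongr)
  have h8 : e * ‖v - S.starProjection v‖ ≤ σ * (1 / 100 * ‖v‖) := by gcongr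
  have h9 : σ * (99 / 100 * ‖v‖) ≤ σ * ‖S.starProjection v‖ := by gcongr; linarith
  have : 0 ≤ σ * ‖v‖ := by positivity
  linarith

theorem gram_block_contract (hG : IsGram G W) (hη : 0 ≤ η) (hη' : η ≤ 1 / 100) {q : ℝ}
    (hq' : q ≤ 1)
    {v : E} (hv : v ∈ S₀) (hlow : q * ‖v‖ ^ 2 ≤ ‖W v‖ ^ 2) :
    ‖v - η • S₀.starProjection (G v)‖ ≤ (1 - η * q / 2) * ‖v‖ := by
  have hnn : 0 ≤ 1 - η * q / 2 := by nlinarith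
  apply abs_le_of_sq_le_sq' _ (by positivity) |>.2
  have h0 : ⟪v, S₀.starProjection (G v)⟫_ℝ = ‖W v‖ ^ 2 := by
    have := S₀.starProjection_inner_eq_zero (G v) v hv
    rw [inner_sub_left, hG.inner_self] at this
    rw [real_inner_comm]; linarith
  rw [norm_sub_sq_real, inner_smul_right, h0, norm_smul, mul_pow, Real.norm_of_nonneg hη, mul_pow]
  have h1 : ‖S₀.starProjection (G v)‖ ^ 2 ≤ 2 * ‖W v‖ ^ 2 :=
    (by gcongr; exact S₀.norm_starProjection_apply_le _ : _ ≤ ‖G v‖ ^ 2).trans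
      (hG.norm_apply_sq_le v)
  have h2 : η ^ 2 * ‖S₀.starProjection (G v)‖ ^ 2 ≤ η * (1 / 100) * (2 * ‖W v‖ ^ 2) := by
    gcongr; nlinarith
  have h3 : η * (q * ‖v‖ ^ 2) ≤ η * ‖W v‖ ^ 2 := by gcongr
  nlinarith [sq_nonneg (η * q * ‖v‖), mul_nonneg hη (sq_nonneg ‖W v‖)]

/-- The main term is `(1 - η G) R (1 - η V G) v`, arranged so that `R` acts on a vector of `S₀`,
where `ψ` controls it. Replacing `G v` by `V (G v)` costs the term in `R v - V (R v)`, since `G v`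
and `R v` have the same component off `S₀`. -/
theorem residual_step_identity (hX : IsTarget X S₀ s) (v : E) :
    let V := S₀.starProjection
    let M := G - X + D
    let A := (1 - η • M : E →L[ℝ] E)
    let R := G - X
    A (G (A v)) - X v = (R (v - η • V (G v)) - η • G (R (v - η • V (G v))))
      - η ^ 2 • G (R (V (G v))) - η • R (R v - V (R v)) - η • (D (G v) + G (D v))
      + η ^ 2 • M (G (R v + D v)) := by
  intro V M A R
  have hVX : V (X v) = X v := S₀.starProjection_eq_self_iff.2 (hX.mem v)
  simp only [A, M, R, sub_apply, one_apply_eq_self, smul_apply, add_apply, map_sub, map_smul,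
    map_add, hVX]
  module

theorem residual_step (hG : IsGram G W) (hX : IsTarget X S₀ s) (hD : IsSmallSymm D ω)
    (hS : IsSplitting W S₀ S e σ τ) (hs : 0 < s) (hs1 : s ≤ 1) (he : 0 ≤ e) (hτ : 0 ≤ τ)
    (hω0 : 0 ≤ ω) (hω : ω ≤ 1) (hη : 0 ≤ η) (hη' : η ≤ s / 5000) (hτ' : τ ≤ s / 2000)
    (he' : e ≤ s / 2000) (hσ : 0 < σ) (hσ' : s / 20 ≤ σ ^ 2) (heσ : e ≤ σ) (hψ0 : 0 ≤ ψ)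
    (hψ : ∀ v ∈ S₀, ‖(G - X) v‖ ≤ ψ * ‖v‖) {v : E} (hv : v ∈ S₀) :
    let A := (1 - η • (G - X + D) : E →L[ℝ] E)
    ‖A (G (A v)) - X v‖ ≤ ((1 - η * s / 120) * ψ + 5 * η * ω) * ‖v‖ := by
  intro A
  have hid := residual_step_identity (G := G) (D := D) (η := η) hX v
  simp only at hid
  rw [hid]
  have hη1 : η ≤ 1 / 100 := by linarith
  set R := G - X with hR
  set V := S₀.starProjection with hV
  have hVm : ∀ z, V z ∈ S₀ := fun z => S₀.starProjection_apply_mem z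
  have hVn : ∀ z, ‖V z‖ ≤ ‖z‖ := fun z => S₀.norm_starProjection_apply_le z
  -- `(9/10)² · s/20 = 0.0405 s ≥ s/25`.
  have hlow : s / 25 * ‖v‖ ^ 2 ≤ ‖W v‖ ^ 2 := by
    have h1 := hS.le_norm_apply_of_mem hτ (by linarith) hσ heσ hv
    have h2 : (9 / 10 * σ * ‖v‖) ^ 2 ≤ ‖W v‖ ^ 2 := by gcongr
    have h3 : s / 20 * ‖v‖ ^ 2 ≤ σ ^ 2 * ‖v‖ ^ 2 := by gcongr
    nlinarith [sq_nonneg ‖v‖]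
  have t1 : ‖R (v - η • V (G v)) - η • G (R (v - η • V (G v)))‖
      ≤ ψ * ((1 - η * s / 50) * ‖v‖) := by
    refine (hG.contract_norm_le hη (by linarith) _).trans ?_
    refine (hψ _ (S₀.sub_mem hv (S₀.smul_mem _ (hVm _)))).trans ?_
    have := gram_block_contract (S₀ := S₀) hG hη hη1 (q := s / 25) (by linarith) hv hlow
    gcongr
    refine this.trans (le_of_eq ?_)
    ring
  have t2 : ‖G (R (V (G v)))‖ ≤ 4 * (ψ * ‖v‖) := by
    have h1 := hG.norm_apply_le (R (V (G v)))
    have h2 := hψ _ (hVm (G v))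
    have h3 : ψ * ‖V (G v)‖ ≤ ψ * (2 * ‖v‖) := by
      gcongr; exact (hVn _).trans (hG.norm_apply_le v)
    linarith
  -- On `S₀ᗮ` the target vanishes, so `R` equals `G` there, and `W` is small there because `S₀ᗮ` is
  -- close to `Sᗮ`.
  have t3 : ‖R (R v - V (R v))‖ ≤ (2 * τ + 2 * e) * (ψ * ‖v‖) := by
    set k := R v - V (R v) with hk
    have hkm : k ∈ S₀ᗮ := S₀.sub_starProjection_mem_orthogonal _
    have hXk : X k = 0 := by
      rw [← hX.apply_starProjection, S₀.starProjection_apply_eq_zero_iff.2 hkm, map_zero]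
    have h1 : R k = G k := by simp [hR, hXk]
    have h2 := hS.norm_apply_le_of_orthogonal hG he hτ hkm
    have h3 := hG.norm_apply_le_norm k
    have h4 : ‖k‖ ≤ ψ * ‖v‖ := (sub_starProjection_norm_le S₀ _).trans (hψ v hv)
    have h5 : √2 * √2 = 2 := Real.mul_self_sqrt (by norm_num)
    have h6 : √2 ≤ 2 := by nlinarith [Real.sqrt_nonneg 2]
    rw [h1]
    calc _ ≤ _ := h3
      _ ≤ √2 * ((√2 * τ + e) * (ψ * ‖v‖)) := by gcongr; exact h2.trans (by gcongr)
      _ = ((√2 * √2) * τ + √2 * e) * (ψ * ‖v‖) := by ring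
      _ ≤ _ := by rw [h5]; gcongr
  have t4 : ‖D (G v) + G (D v)‖ ≤ 4 * (ω * ‖v‖) := by
    refine (norm_add_le _ _).trans ?_
    have h1 := hD.norm_le (G v)
    have h2 : ω * ‖G v‖ ≤ ω * (2 * ‖v‖) := by gcongr; exact hG.norm_apply_le v
    have h3 := hG.norm_apply_le (D v)
    have h4 := hD.norm_le v
    linarith
  have t5 : ‖(R + D) (G (R v + D v))‖ ≤ 8 * (ψ * ‖v‖ + ω * ‖v‖) := by
    have h1 := residual_norm_le hG hX hD hω (G (R v + D v))
    have h2 := hG.norm_apply_le (R v + D v)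
    have h3 : ‖R v + D v‖ ≤ ψ * ‖v‖ + ω * ‖v‖ :=
      (norm_add_le _ _).trans (add_le_add (hψ v hv) (hD.norm_le v))
    simp only [← hR] at h1
    linarith
  have tri : ∀ a b c d f : E, ‖a - b - c - d + f‖ ≤ ‖a‖ + ‖b‖ + ‖c‖ + ‖d‖ + ‖f‖ := by
    intro a b c d f
    refine (norm_add_le _ _).trans ?_
    gcongr
    refine (norm_sub_le _ _).trans ?_
    gcongr
    refine (norm_sub_le _ _).trans ?_
    gcongr
    exact norm_sub_le _ _
  refine (tri _ _ _ _ _).trans ?_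
  simp only [norm_smul, Real.norm_of_nonneg hη, Real.norm_of_nonneg (sq_nonneg η)]
  have hψv : 0 ≤ ψ * ‖v‖ := by positivity
  have hωv : 0 ≤ ω * ‖v‖ := by positivity
  have hη2 : η ^ 2 ≤ η * (s / 5000) := by rw [sq]; gcongr
  have u2 : η ^ 2 * ‖G (R (V (G v)))‖ ≤ η * (s / 5000) * (4 * (ψ * ‖v‖)) := by gcongr
  have u3 : η * ‖R (R v - V (R v))‖ ≤ η * ((2 * (s / 2000) + 2 * (s / 2000)) * (ψ * ‖v‖)) := by
    gcongr; exact t3.trans (by gcongr)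
  have u4 : η * ‖D (G v) + G (D v)‖ ≤ η * (4 * (ω * ‖v‖)) := by gcongr
  have u5 : η ^ 2 * ‖(R + D) (G (R v + D v))‖ ≤ η * (s / 5000) * (8 * (ψ * ‖v‖ + ω * ‖v‖)) := by
    gcongr
  have hsη : 0 ≤ η * s * (ψ * ‖v‖) := by positivity
  have hsω : η * s * (ω * ‖v‖) ≤ η * 1 * (ω * ‖v‖) := by gcongr
  have hηω : 0 ≤ η * (ω * ‖v‖) := by positivity
  linarith

/-- A bound for `G - X` in terms of its restriction to `S₀` and the noise level. -/
theorem residual_norm_le_of_block (hG : IsGram G W) (hX : IsTarget X S₀ s)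
    (hS : IsSplitting W S₀ S e σ τ) (he : 0 ≤ e) (hτ : 0 ≤ τ) (hτ' : τ ≤ 1 / 10) (hψ0 : 0 ≤ ψ)
    (hψ : ∀ v ∈ S₀, ‖(G - X) v‖ ≤ ψ * ‖v‖) (z : E) :
    ‖(G - X) z‖ ≤ (4 * ψ + 2 * e ^ 2) * ‖z‖ := by
  set V := S₀.starProjection with hV
  set R := G - X with hR
  have hRs : ∀ x y, ⟪R x, y⟫_ℝ = ⟪x, R y⟫_ℝ := fun x y => by
    simp only [hR, sub_apply, inner_sub_left, inner_sub_right, hG.symm, hX.symm]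
  set L : E →L[ℝ] E := W ∘L S₀ᗮ.starProjection with hL
  set l := ‖L‖ with hl
  have hl0 : 0 ≤ l := norm_nonneg _
  have hWl : ∀ k ∈ S₀ᗮ, ‖W k‖ ≤ l * ‖k‖ := fun k hk => by
    have := L.le_opNorm k
    simpa [hL, S₀ᗮ.starProjection_eq_self_iff.2 hk] using this
  have hXk : ∀ k ∈ S₀ᗮ, X k = 0 := fun k hkm => by
    rw [← hX.apply_starProjection, S₀.starProjection_apply_eq_zero_iff.2 hkm, map_zero]
  -- With `y` the projection of `k` to `S`, split `k = (k - y) + V y + (y - V y)`: the pieces are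
  -- controlled by the noise, by `ψ`, and by `l` times second order in `τ`. As `l` is the norm of
  -- `W` on `S₀ᗮ`, this is a self-improving inequality for `l`.
  have key : ∀ k ∈ S₀ᗮ, ‖W k‖ ^ 2 ≤ (l * e + ψ * τ + l ^ 2 * τ ^ 2) * ‖k‖ ^ 2 := by
    intro k hk
    set y := S.starProjection k with hy
    have hyS : y ∈ S := S.starProjection_apply_mem _
    have hyn : ‖y‖ ≤ τ * ‖k‖ := hS.norm_starProjection_le_of_orthogonal hτ hk
    have a1 : ⟪G k, k - y⟫_ℝ ≤ l * e * ‖k‖ ^ 2 := by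
      calc _ ≤ ‖W k‖ * ‖W (k - y)‖ := (le_abs_self _).trans (hG.inner_le _ _)
        _ ≤ (l * ‖k‖) * (e * ‖k‖) := by
          gcongr
          · exact hWl k hk
          · exact (hS.noise _ (S.sub_starProjection_mem_orthogonal k)).trans
              (by gcongr; exact sub_starProjection_norm_le S k)
        _ = _ := by ring
    have a2 : ⟪G k, V y⟫_ℝ ≤ ψ * τ * ‖k‖ ^ 2 := by
      have h1 : ⟪G k, V y⟫_ℝ = ⟪k, R (V y)⟫_ℝ := by
        rw [← hRs]; simp [hR, hXk k hk]
      rw [h1]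
      calc _ ≤ ‖k‖ * ‖R (V y)‖ := real_inner_le_norm _ _
        _ ≤ ‖k‖ * (ψ * (τ * ‖k‖)) := by
          gcongr
          refine (hψ _ (S₀.starProjection_apply_mem y)).trans ?_
          gcongr
          exact (S₀.norm_starProjection_apply_le y).trans hyn
        _ = _ := by ring
    have a3 : ⟪G k, y - V y⟫_ℝ ≤ l ^ 2 * τ ^ 2 * ‖k‖ ^ 2 := by
      calc _ ≤ ‖W k‖ * ‖W (y - V y)‖ := (le_abs_self _).trans (hG.inner_le _ _)
        _ ≤ (l * ‖k‖) * (l * (τ * (τ * ‖k‖))) := by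
          gcongr
          · exact hWl k hk
          · refine (hWl _ (S₀.sub_starProjection_mem_orthogonal y)).trans ?_
            gcongr
            exact (hS.norm_proj_sub_le hτ hyS).trans (by gcongr)
        _ = _ := by ring
    have h2 : ‖W k‖ ^ 2 = ⟪G k, k - y⟫_ℝ + ⟪G k, V y⟫_ℝ + ⟪G k, y - V y⟫_ℝ := by
      rw [← hG.inner_self, ← inner_add_right, ← inner_add_right]
      congr 1; abel
    rw [h2]; linarith
  have hl2 : l ^ 2 ≤ 2 * e ^ 2 + 2 * ψ := by
    have hc0 : 0 ≤ l * e + ψ * τ + l ^ 2 * τ ^ 2 := by positivity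
    have h1 : l ≤ √(l * e + ψ * τ + l ^ 2 * τ ^ 2) := by
      refine L.opNorm_le_bound (Real.sqrt_nonneg _) fun z => ?_
      have hk := S₀ᗮ.starProjection_apply_mem z
      have h2 := key _ hk
      have h3 : ‖L z‖ ≤ √(l * e + ψ * τ + l ^ 2 * τ ^ 2) * ‖S₀ᗮ.starProjection z‖ := by
        apply abs_le_of_sq_le_sq' _ (by positivity) |>.2
        rw [mul_pow, Real.sq_sqrt hc0]; exact h2
      exact h3.trans (by gcongr; exact S₀ᗮ.norm_starProjection_apply_le z)
    have h2 : l ^ 2 ≤ l * e + ψ * τ + l ^ 2 * τ ^ 2 := by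
      calc l ^ 2 ≤ √(l * e + ψ * τ + l ^ 2 * τ ^ 2) ^ 2 := by gcongr
        _ = _ := Real.sq_sqrt hc0
    have h3 : l ^ 2 * τ ^ 2 ≤ l ^ 2 * (1 / 10) ^ 2 := by gcongr
    have h4 : ψ * τ ≤ ψ * (1 / 10) := by gcongr
    nlinarith [sq_nonneg (l - 2 * e)]
  have hVR : ∀ k, ‖V (R k)‖ ≤ ψ * ‖k‖ := fun k => by
    apply norm_le_of_inner_self_le _ (by positivity)
    have h1 : ⟪V (R k), V (R k)⟫_ℝ = ⟪k, R (V (R k))⟫_ℝ := by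
      have := S₀.starProjection_inner_eq_zero (R k) _ (S₀.starProjection_apply_mem (R k))
      rw [inner_sub_left] at this
      rw [← hRs]; linarith
    rw [h1]
    calc _ ≤ ‖k‖ * ‖R (V (R k))‖ := real_inner_le_norm _ _
      _ ≤ ‖k‖ * (ψ * ‖V (R k)‖) := by gcongr; exact hψ _ (S₀.starProjection_apply_mem _)
      _ = _ := by ring
  have hperp : ∀ k ∈ S₀ᗮ, ‖R k - V (R k)‖ ≤ l ^ 2 * ‖k‖ := fun k hk => by
    apply norm_le_of_inner_self_le _ (by positivity)
    set n := R k - V (R k) with hn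
    have hnm : n ∈ S₀ᗮ := S₀.sub_starProjection_mem_orthogonal _
    have h1 : ⟪n, n⟫_ℝ = ⟪G k, n⟫_ℝ := by
      have h2 : ⟪n, n⟫_ℝ = ⟪R k, n⟫_ℝ - ⟪V (R k), n⟫_ℝ := by rw [← inner_sub_left]
      have h3 : R k = G k := by simp [hR, hXk k hk]
      rw [h2, S₀.inner_right_of_mem_orthogonal (S₀.starProjection_apply_mem _) hnm, sub_zero, h3]
    rw [h1]
    calc _ ≤ ‖W k‖ * ‖W n‖ := (le_abs_self _).trans (hG.inner_le _ _)
      _ ≤ (l * ‖k‖) * (l * ‖n‖) := by gcongr; exacts [hWl k hk, hWl n hnm]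
      _ = _ := by ring
  set k := z - V z with hk
  have hkm : k ∈ S₀ᗮ := S₀.sub_starProjection_mem_orthogonal _
  have hkn : ‖k‖ ≤ ‖z‖ := sub_starProjection_norm_le S₀ z
  have h1 : R z = R (V z) + (V (R k) + (R k - V (R k))) := by
    rw [add_sub_cancel, ← map_add, hk]; congr 1; abel
  rw [h1]
  have b1 : ‖R (V z)‖ ≤ ψ * ‖z‖ :=
    (hψ _ (S₀.starProjection_apply_mem z)).trans
      (by gcongr; exact S₀.norm_starProjection_apply_le z)
  have b2 : ‖V (R k)‖ ≤ ψ * ‖z‖ := (hVR k).trans (by gcongr)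
  have b3 : ‖R k - V (R k)‖ ≤ (2 * e ^ 2 + 2 * ψ) * ‖z‖ := (hperp k hkm).trans (by gcongr)
  have b4 : ‖R (V z) + (V (R k) + (R k - V (R k)))‖
      ≤ ‖R (V z)‖ + (‖V (R k)‖ + ‖R k - V (R k)‖) :=
    (norm_add_le _ _).trans (by gcongr; exact norm_add_le _ _)
  linarith

end FD

end

/-! ### Trajectories: the growth phase and the convergence phase. -/

section

variable {E : Type*} [NormedAddCommGroup E] [InnerProductSpace ℝ E]

/-- The difference `G - X` without the compression of `G` to the complement of `S`. -/
def lowRankPart (G X : E →L[ℝ] E) (S : Submodule ℝ E) [S.HasOrthogonalProjection] : E →L[ℝ] E :=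
  G - X - Sᗮ.starProjection * G * Sᗮ.starProjection

section Splitting
variable {G W X D : E →L[ℝ] E} {S₀ S : Submodule ℝ E} {s ω e σ τ η ψ e' σ' τ' : ℝ}

theorem difference_norm_le (hG : IsGram G W) (hX : IsTarget X S₀ s) (x : E) :
    ‖(G - X) x‖ ≤ 3 * ‖x‖ := by
  rw [sub_apply]
  refine (norm_sub_le _ _).trans ?_
  linarith [hG.norm_apply_le x, hX.norm_le x]

variable [FiniteDimensional ℝ E]

theorem IsSplitting.mono (h : IsSplitting W S₀ S e σ τ) (he : e ≤ e') (hσ : σ' ≤ σ)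
    (hτ : τ ≤ τ') : IsSplitting W S₀ S e' σ' τ' where
  noise k hk := (h.noise k hk).trans (by gcongr)
  signal y hy := le_trans (by gcongr) (h.signal y hy)
  tilt y hy := (h.tilt y hy).trans (by gcongr)
  finrank_eq := h.finrank_eq

theorem IsSplitting.step (hG : IsGram G W) (hX : IsTarget X S₀ s) (hD : IsSmallSymm D ω)
    (hS : IsSplitting W S₀ S e σ τ) (hs : 0 < s) (hs1 : s ≤ 1) (he : 0 ≤ e) (hτ : 0 ≤ τ)
    (hω0 : 0 ≤ ω) (hη : 0 ≤ η) (hη' : η ≤ s / 5000) (hτ' : τ ≤ s / 2000)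
    (hρ : 2 * e + ω ≤ s / 200) (hσ : 0 < σ) (hσ' : σ ^ 2 ≤ s / 20) (heσ : e ≤ σ) :
    let A := (1 - η • (G - X + D) : E →L[ℝ] E)
    IsSplitting (W * A) S₀ (S.map (A : E →ₗ[ℝ] E)) (e * (1 + η * (τ ^ 2 + ω)))
      (σ * (1 + η * s / 10)) ((1 - η * s / 2) * τ + 3 * η * (2 * e + ω)) := by
  intro A
  refine ⟨fun k hk => noise_step hG hX hD hS he hτ hω0 (by linarith) hη (by linarith) hk,
    fun y hy => signal_step hG hX hD hS hs hs1 he hτ hω0 hη (by linarith) (by linarith)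
      (by linarith) hσ hσ' heσ hy,
    fun y hy => tilt_step hG hX hD hS hs hs1 he hτ hω0 hη (by linarith) (by linarith)
      (by linarith) hy, ?_⟩
  -- Injectivity of `A` keeps the dimension of `S` unchanged.
  have hinj : Function.Injective (A : E →ₗ[ℝ] E) := by
    rw [injective_iff_map_eq_zero]
    intro x hx
    have h1 := step_norm_ge (residual_norm_le hG hX hD (by linarith)) hη x
    have h2 : A x = 0 := hx
    rw [show (1 - η • (G - X + D) : E →L[ℝ] E) x = 0 from h2, norm_zero] at h1
    have h3 : 0 < 1 - 4 * η := by linarith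
    have h4 : ‖x‖ ≤ 0 := by
      by_contra! h; nlinarith
    exact norm_le_zero_iff.1 h4
  rw [← hS.finrank_eq]
  exact (Submodule.equivMapOfInjective _ hinj S).finrank_eq.symm

theorem lowRankPart_norm_le (hG : IsGram G W) (hn : ∀ k ∈ Sᗮ, ‖W k‖ ≤ e * ‖k‖) (he : 0 ≤ e)
    {a : ℝ} (ha : ∀ x, ‖(G - X) x‖ ≤ a * ‖x‖) (x : E) :
    ‖lowRankPart G X S x‖ ≤ (a + e ^ 2) * ‖x‖ := by
  have h1 := norm_compress_orthogonal_le hG hn he x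
  have h2 : lowRankPart G X S x
      = (G - X) x - Sᗮ.starProjection (G (Sᗮ.starProjection x)) := rfl
  rw [h2]
  refine (norm_sub_le _ _).trans ?_
  linarith [ha x]

end Splitting

variable [FiniteDimensional ℝ E]

/-- Gradient descent at the level of `G = U Uᵀ` and `W = Uᵀ`, driven by an error `D` that is
controlled through every decomposition into a low-rank part and a small remainder. -/
structure IsTrajectory (X : E →L[ℝ] E) (S₀ : Submodule ℝ E) (s η δ α : ℝ) (r d : ℕ)
    (G W D : ℕ → E →L[ℝ] E) : Prop where
  target : IsTarget X S₀ s
  inner_eq : ∀ t x y, ⟪G t x, y⟫_ℝ = ⟪W t x, W t y⟫_ℝ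
  W_zero : ∀ x, ‖W 0 x‖ = α * ‖x‖
  G_succ : ∀ t, G (t + 1) = (1 - η • (G t - X + D t)) * G t * (1 - η • (G t - X + D t))
  W_succ : ∀ t, W (t + 1) = W t * (1 - η • (G t - X + D t))
  finrank_le : Module.finrank ℝ S₀ ≤ r
  D_symm : ∀ t x y, ⟪D t x, y⟫_ℝ = ⟪x, D t y⟫_ℝ
  D_small : ∀ t (S : Submodule ℝ E) (e ξ : ℝ), Module.finrank ℝ S ≤ r → 0 ≤ e → 0 ≤ ξ →
    (∀ k ∈ Sᗮ, ‖W t k‖ ≤ e * ‖k‖) → (∀ x, ‖lowRankPart (G t) X S x‖ ≤ ξ * ‖x‖) →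
    ∀ x, ‖D t x‖ ≤ δ * (√(3 * r) * ξ + d * e ^ 2) * ‖x‖

namespace IsTrajectory

variable {X : E →L[ℝ] E} {S₀ : Submodule ℝ E} {s η δ α ebar : ℝ} {r d : ℕ}
  {G W D : ℕ → E →L[ℝ] E}

/-- Uses only `‖G - X‖ ≤ 3`, so `ξ = 3 + e² ≤ 4` and `√3 · 4 ≤ 7`. -/
theorem crude_bound (h : IsTrajectory X S₀ s η δ α r d G W D) {t : ℕ} {S : Submodule ℝ E}
    {e σ τ : ℝ} (hδ : 0 ≤ δ) (hG : IsGram (G t) (W t)) (hS : IsSplitting (W t) S₀ S e σ τ)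
    (he : 0 ≤ e) (hee : e ≤ ebar) (he1 : ebar ≤ 1) :
    IsSmallSymm (D t) (δ * (7 * √r + d * ebar ^ 2)) := by
  refine ⟨h.D_symm t, fun x => ?_⟩
  have hlow := lowRankPart_norm_le hG hS.noise he (difference_norm_le hG h.target)
  refine (h.D_small t S e (3 + e ^ 2) (hS.finrank_eq.le.trans h.finrank_le) he (by positivity)
    hS.noise hlow x).trans ?_
  have h3 : √3 ≤ 7 / 4 := Real.sqrt_le_iff.2 ⟨by norm_num, by norm_num⟩
  have h4 : e ^ 2 ≤ 1 := by nlinarith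
  have key : √(3 * r) * (3 + e ^ 2) + d * e ^ 2 ≤ 7 * √r + d * ebar ^ 2 := by
    rw [Real.sqrt_mul (by norm_num)]
    have h5 : d * e ^ 2 ≤ d * ebar ^ 2 := by gcongr
    have h6 : √3 * √r * (3 + e ^ 2) ≤ 7 / 4 * √r * (3 + 1) := by gcongr
    linarith
  exact mul_le_mul_of_nonneg_right (mul_le_mul_of_nonneg_left key hδ) (norm_nonneg x)

/-- Here `ξ = 4ψ + 3e²`, so the error shrinks together with the residual, down to the noise floor.
-/
theorem fine_bound (h : IsTrajectory X S₀ s η δ α r d G W D) {t : ℕ} {S : Submodule ℝ E}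
    {e σ τ ψ : ℝ} (hδ : 0 ≤ δ) (hrd : √r ≤ d) (hG : IsGram (G t) (W t))
    (hS : IsSplitting (W t) S₀ S e σ τ)
    (he : 0 ≤ e) (hτ : 0 ≤ τ) (hτ' : τ ≤ 1 / 10) (hψ0 : 0 ≤ ψ)
    (hψ : ∀ v ∈ S₀, ‖(G t - X) v‖ ≤ ψ * ‖v‖) :
    IsSmallSymm (D t) (δ * (7 * √r * ψ + 7 * (d * e ^ 2))) := by
  refine ⟨h.D_symm t, fun x => ?_⟩
  have hlow := lowRankPart_norm_le hG hS.noise he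
    (residual_norm_le_of_block hG h.target hS he hτ hτ' hψ0 hψ)
  refine (h.D_small t S e _ (hS.finrank_eq.le.trans h.finrank_le) he (by positivity)
    hS.noise hlow x).trans ?_
  have h3 : √3 ≤ 7 / 4 := Real.sqrt_le_iff.2 ⟨by norm_num, by norm_num⟩
  have key : √(3 * r) * (4 * ψ + 2 * e ^ 2 + e ^ 2) + d * e ^ 2
      ≤ 7 * √r * ψ + 7 * (d * e ^ 2) := by
    rw [Real.sqrt_mul (by norm_num)]
    have h5 : √r * e ^ 2 ≤ d * e ^ 2 := by gcongr
    have h6 : √3 * √r * (4 * ψ + 2 * e ^ 2 + e ^ 2)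
        ≤ 7 / 4 * √r * (4 * ψ + 2 * e ^ 2 + e ^ 2) := by gcongr
    have h7 : 0 ≤ d * e ^ 2 := by positivity
    linarith
  exact mul_le_mul_of_nonneg_right (mul_le_mul_of_nonneg_left key hδ) (norm_nonneg x)

/-- The growth phase. -/
theorem growth_phase (h : IsTrajectory X S₀ s η δ α r d G W D) (hs : 0 < s) (hs1 : s ≤ 1)
    (hη : 0 ≤ η) (hη' : η ≤ s / 5000) (hδ : 0 ≤ δ) (hα : 0 < α) (hebar : ebar ≤ s ^ 2 / 48000)
    (hω : δ * (7 * √r + d * ebar ^ 2) ≤ s ^ 2 / 24000) (t : ℕ)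
    (ht : α * (1 + η * s / 4000) ^ t ≤ ebar) :
    ∃ S : Submodule ℝ E, IsGram (G t) (W t) ∧
      IsSplitting (W t) S₀ S (α * (1 + η * s / 4000) ^ t)
        (min (α * (1 + η * s / 10) ^ t) √(s / 20)) (s / 2000) := by
  have hss : s ^ 2 ≤ s := by nlinarith
  have hηs : 0 ≤ η * s := by positivity
  induction t with
  | zero =>
    simp only [pow_zero, mul_one] at ht ⊢
    refine ⟨S₀, ⟨h.inner_eq 0, fun y => ?_⟩, fun k _ => (h.W_zero k).le, fun y _ => ?_,
      fun y hy => ?_, rfl⟩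
    · rw [h.W_zero, mul_pow]; gcongr; nlinarith
    · rw [h.W_zero]; gcongr; exact min_le_left _ _
    · rw [S₀.starProjection_eq_self_iff.2 hy, sub_self, norm_zero]; positivity
  | succ t ih =>
    have hgrow : α * (1 + η * s / 4000) ^ t ≤ α * (1 + η * s / 4000) ^ (t + 1) := by
      gcongr <;> linarith
    obtain ⟨S, hG, hS⟩ := ih (hgrow.trans ht)
    have hee := hgrow.trans ht
    set e := α * (1 + η * s / 4000) ^ t with he
    -- The signal is truncated at `√(s / 20)`, beyond which `signal_step` no longer applies.
    set σ := min (α * (1 + η * s / 10) ^ t) √(s / 20) with hσ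
    set ω := δ * (7 * √r + d * ebar ^ 2) with hωd
    have he0 : 0 ≤ e := by positivity
    have hω0 : 0 ≤ ω := by positivity
    have hD := h.crude_bound hδ hG hS he0 hee (by nlinarith)
    have hσ0 : 0 < σ := lt_min (by positivity) (by positivity)
    have hσ2 : σ ^ 2 ≤ s / 20 := by
      calc σ ^ 2 ≤ √(s / 20) ^ 2 := by gcongr; exact min_le_right _ _
        _ = _ := Real.sq_sqrt (by positivity)
    have heσ : e ≤ σ := by
      refine le_min (by rw [he]; gcongr; norm_num) (Real.le_sqrt_of_sq_le ?_)
      have : e ≤ s / 48000 := by linarith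
      nlinarith
    have hstep := hS.step hG h.target hD hs hs1 he0 (by positivity) hω0 hη hη' le_rfl
      (by nlinarith) hσ0 hσ2 heσ
    have hgram := isGram_step hG h.target hD (by linarith) hη (by linarith)
    refine ⟨S.map ((1 - η • (G t - X + D t) : E →L[ℝ] E) : E →ₗ[ℝ] E), ?_, ?_⟩
    · rw [h.G_succ, h.W_succ]; exact hgram
    · rw [h.W_succ]
      refine hstep.mono ?_ ?_ ?_
      · rw [show α * (1 + η * s / 4000) ^ (t + 1) = e * (1 + η * s / 4000) by
            rw [he, pow_succ]; ring]
        have : (s / 2000) ^ 2 + ω ≤ s / 4000 := by nlinarith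
        have : η * ((s / 2000) ^ 2 + ω) ≤ η * (s / 4000) := by gcongr
        gcongr
        linarith
      · refine le_trans (min_le_min (le_of_eq ?_) (le_mul_of_one_le_right (by positivity)
          (?_ : 1 ≤ 1 + η * s / 10))) (min_mul_of_nonneg _ _ (by positivity)).ge
        · rw [pow_succ]; ring
        · linarith
      · have : 3 * η * (2 * e + ω) ≤ 3 * η * (s ^ 2 / 12000) := by gcongr; linarith
        nlinarith

/-- One step of the convergence phase on the scalar quantities. -/
theorem exists_step (h : IsTrajectory X S₀ s η δ α r d G W D) (hs : 0 < s) (hs1 : s ≤ 1)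
    (hη : 0 ≤ η) (hη' : η ≤ s / 5000) (hδ : 0 ≤ δ) (hrd : √r ≤ d) (hebar : ebar ≤ s ^ 2 / 48000)
    (hω : δ * (7 * √r + d * ebar ^ 2) ≤ s ^ 2 / 24000) {t : ℕ} {S : Submodule ℝ E}
    {e τ ψ : ℝ} (he : 0 ≤ e) (hee : e ≤ ebar) (hτ : 0 ≤ τ) (hτ' : τ ≤ s / 2000) (hψ0 : 0 ≤ ψ)
    (hG : IsGram (G t) (W t)) (hS : IsSplitting (W t) S₀ S e √(s / 20) τ)
    (hψ : ∀ v ∈ S₀, ‖(G t - X) v‖ ≤ ψ * ‖v‖) :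
    ∃ (S' : Submodule ℝ E) (ω : ℝ), 0 ≤ ω ∧ ω ≤ s ^ 2 / 24000 ∧
      ω ≤ δ * (7 * √r * ψ + 7 * (d * e ^ 2)) ∧ IsGram (G (t + 1)) (W (t + 1)) ∧
      IsSplitting (W (t + 1)) S₀ S' (e * (1 + η * (τ ^ 2 + ω))) √(s / 20)
        ((1 - η * s / 2) * τ + 3 * η * (2 * e + ω)) ∧
      ∀ v ∈ S₀, ‖(G (t + 1) - X) v‖ ≤ ((1 - η * s / 120) * ψ + 5 * η * ω) * ‖v‖ := by
  have hss : s ^ 2 ≤ s := by nlinarith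
  have hηs : 0 ≤ η * s := by positivity
  have hebar0 : 0 ≤ ebar := he.trans hee
  have hD1 := h.crude_bound hδ hG hS he hee (by nlinarith)
  have hD2 := h.fine_bound hδ hrd hG hS he hτ (by linarith) hψ0 hψ
  set ω := min (δ * (7 * √r + d * ebar ^ 2)) (δ * (7 * √r * ψ + 7 * (d * e ^ 2))) with hωd
  have hω0 : 0 ≤ ω := by positivity
  have hω1 : ω ≤ s ^ 2 / 24000 := (min_le_left _ _).trans hω
  have hD : IsSmallSymm (D t) ω := by
    rcases min_choice (δ * (7 * √r + d * ebar ^ 2)) (δ * (7 * √r * ψ + 7 * (d * e ^ 2)))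
      with h1 | h1
    · rw [hωd, h1]; exact hD1
    · rw [hωd, h1]; exact hD2
  have hσ2 : √(s / 20) ^ 2 = s / 20 := Real.sq_sqrt (by positivity)
  have hσ0 : 0 < √(s / 20) := by positivity
  have heσ : e ≤ √(s / 20) := by
    refine Real.le_sqrt_of_sq_le ?_
    have : e ≤ s / 48000 := by linarith
    nlinarith
  have hstep := hS.step hG h.target hD hs hs1 he hτ hω0 hη hη' hτ' (by linarith) hσ0 hσ2.le heσ
  have hgram := isGram_step hG h.target hD (by linarith) hη (by linarith)
  refine ⟨_, ω, hω0, hω1, min_le_right _ _, by rw [h.G_succ, h.W_succ]; exact hgram,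
    by rw [h.W_succ]; exact hstep.mono le_rfl (le_mul_of_one_le_right hσ0.le (by linarith)) le_rfl,
    fun v hv => ?_⟩
  have := residual_step hG h.target hD hS hs hs1 he hτ hω0 (by linarith) hη hη' hτ'
    (by linarith) hσ0 hσ2.ge heσ hψ0 hψ hv
  rw [h.G_succ]
  exact this

set_option maxHeartbeats 800000 in
/-- The convergence phase. -/
theorem convergence_phase (h : IsTrajectory X S₀ s η δ α r d G W D) (hs : 0 < s) (hs1 : s ≤ 1)
    (hη : 0 ≤ η) (hη' : η ≤ s / 5000) (hδ : 0 ≤ δ) (hrd : √r ≤ d) (hebar : ebar ≤ s ^ 2 / 48000)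
    (hω : δ * (7 * √r + d * ebar ^ 2) ≤ s ^ 2 / 24000) (hδr : δ * √r ≤ s / 20000)
    {t : ℕ} {S : Submodule ℝ E} {e₁ : ℝ} (he₁ : 0 ≤ e₁) (he₁' : 3 * e₁ ≤ ebar)
    (hG : IsGram (G t) (W t)) (hS : IsSplitting (W t) S₀ S e₁ √(s / 20) (s / 2000)) (n : ℕ)
    (hn : η * n * (ebar + 14 * δ * (d * ebar ^ 2)) ≤ 1 / 2) :
    ∃ (S' : Submodule ℝ E) (e τ ψ : ℝ), 0 ≤ e ∧ e ≤ ebar ∧ 0 ≤ τ ∧ τ ≤ s / 2000 ∧ 0 ≤ ψ ∧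
      ψ ≤ 3 * (1 - η * s / 200) ^ n + 7000 * δ * (d * ebar ^ 2) / s ∧
      e * Real.exp (τ / 1000 + ψ / 10)
        ≤ e₁ * Real.exp (1 / 2 + η * n * (ebar + 14 * δ * (d * ebar ^ 2))) ∧
      IsGram (G (t + n)) (W (t + n)) ∧ IsSplitting (W (t + n)) S₀ S' e √(s / 20) τ ∧
      ∀ v ∈ S₀, ‖(G (t + n) - X) v‖ ≤ ψ * ‖v‖ := by
  have hss : s ^ 2 ≤ s := by nlinarith
  have hηs : 0 ≤ η * s := by positivity
  have hηs1 : η * s ≤ 1 / 200 := by nlinarith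
  have hebar0 : 0 ≤ ebar := by linarith
  set θ := d * ebar ^ 2 with hθ
  have hθ0 : 0 ≤ θ := by positivity
  set ζ := ebar + 14 * δ * θ with hζ
  have hζ0 : 0 ≤ ζ := by positivity
  induction n with
  | zero =>
    -- Starting values `τ = s / 2000` and `ψ = 3` (from `‖G - X‖ ≤ 3`) make the exponent `τ / 1000 +
    -- ψ / 10` less than `1/2`.
    refine ⟨S, e₁, s / 2000, 3, he₁, by linarith, by positivity, le_rfl, by norm_num, ?_, ?_, hG,
      hS, fun v _ => difference_norm_le hG h.target v⟩
    · simp only [pow_zero, mul_one]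
      have : 0 ≤ 7000 * δ * θ / s := by positivity
      linarith
    · refine mul_le_mul_of_nonneg_left (Real.exp_le_exp.2 ?_) he₁
      rw [Nat.cast_zero, mul_zero, zero_mul]
      linarith
  | succ n ih =>
    have hn' : η * n * ζ ≤ η * (n + 1 : ℕ) * ζ := by gcongr; simp
    obtain ⟨S', e, τ, ψ, he, hee, hτ, hτ', hψ0, hψ1, hexp, hG', hS', hψ⟩ := ih (hn'.trans hn)
    obtain ⟨S'', ω, hω0, hω1, hω2, hG'', hS'', hψ''⟩ := h.exists_step hs hs1 hη hη' hδ hrd hebar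
      hω he hee hτ hτ' hψ0 hG' hS' hψ
    have hω3 : ω ≤ 7 * (δ * √r) * ψ + 7 * δ * θ := by
      refine hω2.trans ?_
      have : δ * (d * e ^ 2) ≤ δ * θ := by rw [hθ]; gcongr
      linarith
    have hω4 : ω ≤ 7 * (s / 20000) * ψ + 7 * δ * θ := hω3.trans (by gcongr)
    have hηω : η * ω ≤ η * (7 * (s / 20000) * ψ + 7 * δ * θ) := by gcongr
    have hηsψ : 0 ≤ η * s * ψ := by positivity
    have hηsτ : 0 ≤ η * s * τ := by positivity
    have hτn0 : 0 ≤ (1 - η * s / 2) * τ + 3 * η * (2 * e + ω) := by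
      have : 0 ≤ 1 - η * s / 2 := by linarith
      positivity
    have hψn0 : 0 ≤ (1 - η * s / 120) * ψ + 5 * η * ω := by
      have : 0 ≤ 1 - η * s / 120 := by linarith
      positivity
    set τ' := (1 - η * s / 2) * τ + 3 * η * (2 * e + ω) with hτ'd
    set ψ' := (1 - η * s / 120) * ψ + 5 * η * ω with hψ'd
    set e' := e * (1 + η * (τ ^ 2 + ω)) with he'd
    have he'0 : 0 ≤ e' := by positivity
    have hexp' : e' * Real.exp (τ' / 1000 + ψ' / 10)
        ≤ e₁ * Real.exp (1 / 2 + η * (n + 1 : ℕ) * ζ) := by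
      have h1 : 1 + η * (τ ^ 2 + ω) ≤ Real.exp (η * (τ ^ 2 + ω)) := by
        rw [add_comm]; exact Real.add_one_le_exp _
      -- The potential inequality: `η τ² ≤ η s τ / 2000` is exactly the decrease of `τ / 1000`; the
      -- part of `ω` proportional to `ψ` is absorbed by the decrease `η s ψ / 1200` of `ψ / 10`; the
      -- rest goes into `η ζ`.
      have h2 : η * (τ ^ 2 + ω) + (τ' / 1000 + ψ' / 10) ≤ τ / 1000 + ψ / 10 + η * ζ := by
        have h3 : η * τ ^ 2 ≤ η * (s / 2000 * τ) := by rw [sq]; gcongr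
        have h4 : η * e ≤ η * ebar := by gcongr
        have h5 : 0 ≤ η * ebar := by positivity
        have h6 : 0 ≤ η * (δ * θ) := by positivity
        simp only [hτ'd, hψ'd, hζ]
        linarith
      calc e' * Real.exp (τ' / 1000 + ψ' / 10)
          ≤ e * Real.exp (η * (τ ^ 2 + ω)) * Real.exp (τ' / 1000 + ψ' / 10) := by
            rw [he'd]; gcongr
        _ = e * Real.exp (η * (τ ^ 2 + ω) + (τ' / 1000 + ψ' / 10)) := by
            rw [Real.exp_add (η * (τ ^ 2 + ω))]; ring
        _ ≤ e * Real.exp (τ / 1000 + ψ / 10 + η * ζ) := by gcongr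
        _ = e * Real.exp (τ / 1000 + ψ / 10) * Real.exp (η * ζ) := by
            rw [Real.exp_add (τ / 1000 + ψ / 10)]; ring
        _ ≤ e₁ * Real.exp (1 / 2 + η * n * ζ) * Real.exp (η * ζ) := by gcongr
        _ = _ := by
            rw [mul_assoc, ← Real.exp_add]; congr 2; push_cast; ring
    refine ⟨S'', e', τ', ψ', he'0, ?_, hτn0, ?_, hψn0, ?_, hexp', hG'', hS'', hψ''⟩
    · have h1 : 1 ≤ Real.exp (τ' / 1000 + ψ' / 10) := Real.one_le_exp (by positivity)
      -- The budget `1/2 + 1/2` in the exponent gives a factor `exp 1 < 3`, matching `3 e₁ ≤ ebar`.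
      have h2 : Real.exp (1 / 2 + η * (n + 1 : ℕ) * ζ) ≤ 3 := by
        have : Real.exp (1 / 2 + η * (n + 1 : ℕ) * ζ) ≤ Real.exp 1 := by gcongr; linarith
        linarith [Real.exp_one_lt_d9]
      calc e' ≤ e' * Real.exp (τ' / 1000 + ψ' / 10) := le_mul_of_one_le_right he'0 h1
        _ ≤ _ := hexp'
        _ ≤ e₁ * 3 := by gcongr
        _ ≤ ebar := by linarith
    · have : 3 * η * (2 * e + ω) ≤ 3 * η * (s ^ 2 / 12000) := by gcongr; linarith
      have h2 : (1 - η * s / 2) * τ ≤ (1 - η * s / 2) * (s / 2000) := by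
        gcongr; linarith
      simp only [hτ'd]
      nlinarith
    · have h1 : ψ' ≤ (1 - η * s / 200) * ψ + 35 * (η * (δ * θ)) := by
        simp only [hψ'd]; linarith
      refine h1.trans ?_
      have h2 : (1 - η * s / 200) * ψ ≤ (1 - η * s / 200)
          * (3 * (1 - η * s / 200) ^ n + 7000 * δ * θ / s) := by
        gcongr; linarith
      -- `7000 δ θ / s` is the fixed point of the affine recursion `h1`.
      have h3 : η * s / 200 * (7000 * δ * θ / s) = 35 * (η * (δ * θ)) := by
        rw [div_mul_div_comm, div_eq_iff (by positivity)]; ring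
      rw [pow_succ]
      linarith

theorem final_bound (h : IsTrajectory X S₀ s η δ α r d G W D) (hs : 0 < s) (hs1 : s ≤ 1)
    (hη : 0 ≤ η) (hη' : η ≤ s / 5000) (hδ : 0 ≤ δ) (hα : 0 < α) (hrd : √r ≤ d)
    (hebar : ebar ≤ s ^ 2 / 48000)
    (hω : δ * (7 * √r + d * ebar ^ 2) ≤ s ^ 2 / 24000) (hδr : δ * √r ≤ s / 20000) {t n : ℕ}
    (ht : 3 * (α * (1 + η * s / 4000) ^ t) ≤ ebar)
    (ht' : √(s / 20) ≤ α * (1 + η * s / 10) ^ t)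
    (hn : η * n * (ebar + 14 * δ * (d * ebar ^ 2)) ≤ 1 / 2) :
    ∃ S : Submodule ℝ E, Module.finrank ℝ S ≤ r ∧ (∀ k ∈ Sᗮ, ‖W (t + n) k‖ ≤ ebar * ‖k‖) ∧
      ∀ x, ‖lowRankPart (G (t + n)) X S x‖ ≤
        (4 * (3 * (1 - η * s / 200) ^ n + 7000 * δ * (d * ebar ^ 2) / s) + 3 * ebar ^ 2) * ‖x‖ := by
  have he₁ : 0 ≤ α * (1 + η * s / 4000) ^ t := by positivity
  obtain ⟨S, hG, hS⟩ := h.growth_phase hs hs1 hη hη' hδ hα hebar hω t (by linarith)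
  rw [min_eq_right ht'] at hS
  obtain ⟨S', e, τ, ψ, he, hee, hτ, hτ', hψ0, hψ1, -, hG', hS', hψ⟩ :=
    h.convergence_phase hs hs1 hη hη' hδ hrd hebar hω hδr he₁ ht hG hS n hn
  refine ⟨S', hS'.finrank_eq.le.trans h.finrank_le, (hS'.mono hee le_rfl le_rfl).noise,
    fun x => ?_⟩
  refine (lowRankPart_norm_le hG' hS'.noise he
    (residual_norm_le_of_block hG' h.target hS' he hτ (by linarith) hψ0 hψ) x).trans ?_
  have : e ^ 2 ≤ ebar ^ 2 := by gcongr
  exact mul_le_mul_of_nonneg_right (by linarith) (norm_nonneg x)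

end IsTrajectory

end

/-! ### Matrices: the restricted isometry property and the error operator. -/

section

variable {d m : ℕ}

theorem matInner_eq_sum (A B : Matrix (Fin d) (Fin d) ℝ) :
    matInner A B = ∑ i, ∑ j, A i j * B i j := by
  simp only [matInner, Matrix.trace, Matrix.diag_apply, Matrix.mul_apply, Matrix.transpose_apply]
  exact Finset.sum_comm

theorem norm_sq_eq_sum (A : Matrix (Fin d) (Fin d) ℝ) : ‖A‖ ^ 2 = ∑ i, ∑ j, A i j ^ 2 := by
  rw [Matrix.frobenius_norm_def, ← Real.rpow_natCast, ← Real.rpow_mul (by positivity)]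
  simp

theorem matInner_self (A : Matrix (Fin d) (Fin d) ℝ) : matInner A A = ‖A‖ ^ 2 := by
  rw [matInner_eq_sum, norm_sq_eq_sum]; simp only [sq]

theorem matInner_comm (A B : Matrix (Fin d) (Fin d) ℝ) : matInner A B = matInner B A := by
  simp only [matInner_eq_sum, mul_comm]

theorem matInner_add_right (A B C : Matrix (Fin d) (Fin d) ℝ) :
    matInner A (B + C) = matInner A B + matInner A C := by
  simp [matInner, mul_add, Matrix.trace_add]

theorem matInner_smul_right (A B : Matrix (Fin d) (Fin d) ℝ) (a : ℝ) :
    matInner A (a • B) = a * matInner A B := by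
  simp [matInner, Matrix.trace_smul]

theorem matInner_sum_right {ι : Type*} (t : Finset ι) (A : Matrix (Fin d) (Fin d) ℝ)
    (B : ι → Matrix (Fin d) (Fin d) ℝ) :
    matInner A (∑ i ∈ t, B i) = ∑ i ∈ t, matInner A (B i) := by
  simp [matInner, Finset.mul_sum, Matrix.trace_sum]

theorem matInner_sub_right (A B C : Matrix (Fin d) (Fin d) ℝ) :
    matInner A (B - C) = matInner A B - matInner A C := by
  simp [matInner, mul_sub, Matrix.trace_sub]

/-- Matrices as operators on Euclidean space. -/
abbrev opOf (M : Matrix (Fin d) (Fin d) ℝ) :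
    EuclideanSpace ℝ (Fin d) →L[ℝ] EuclideanSpace ℝ (Fin d) :=
  Matrix.toEuclideanCLM (𝕜 := ℝ) M

theorem rank_eq_finrank_opOf (M : Matrix (Fin d) (Fin d) ℝ) :
    M.rank = Module.finrank ℝ
      (LinearMap.range (opOf M : EuclideanSpace ℝ (Fin d) →ₗ[ℝ] EuclideanSpace ℝ (Fin d))) := by
  rw [Matrix.coe_toEuclideanCLM_eq_toEuclideanLin, Matrix.toEuclideanLin, Matrix.toLpLin_eq_toLin]
  exact Matrix.rank_eq_finrank_range_toLin _ _ _

theorem rank_add_le (M N : Matrix (Fin d) (Fin d) ℝ) : (M + N).rank ≤ M.rank + N.rank := by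
  simp only [rank_eq_finrank_opOf]
  refine le_trans (Submodule.finrank_mono ?_) (Submodule.finrank_add_le_finrank_add_finrank _ _)
  rintro _ ⟨x, rfl⟩
  have : (opOf (M + N) : EuclideanSpace ℝ (Fin d) →ₗ[ℝ] _) x = opOf M x + opOf N x := by
    simp [opOf, map_add]
  rw [this]
  exact Submodule.add_mem_sup ⟨x, rfl⟩ ⟨x, rfl⟩

theorem rank_smul_le (c : ℝ) (M : Matrix (Fin d) (Fin d) ℝ) : (c • M).rank ≤ M.rank := by
  rw [← one_mul M, ← Matrix.smul_mul, one_mul]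
  exact Matrix.rank_mul_le_right _ _

/-- The bilinear form of the measurements. -/
def measInner (A : Fin m → Matrix (Fin d) (Fin d) ℝ) (M N : Matrix (Fin d) (Fin d) ℝ) : ℝ :=
  1 / (m : ℝ) * ∑ i, matInner (A i) M * matInner (A i) N

/-- Polarisation on `‖N‖ M ± ‖M‖ N`, where the two summands have equal norm. -/
theorem RIP.bilinear {A : Fin m → Matrix (Fin d) (Fin d) ℝ} {k : ℕ} {δ : ℝ} (h : RIP A k δ)
    {M N : Matrix (Fin d) (Fin d) ℝ} (hM : M.IsSymm) (hN : N.IsSymm) (hr : M.rank + N.rank ≤ k) :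
    |measInner A M N - matInner M N| ≤ δ * ‖M‖ * ‖N‖ := by
  rcases eq_or_ne M 0 with rfl | hM0
  · simp [measInner, matInner]
  rcases eq_or_ne N 0 with rfl | hN0
  · simp [measInner, matInner]
  have ha : 0 < ‖M‖ := norm_pos_iff.2 hM0
  have hb : 0 < ‖N‖ := norm_pos_iff.2 hN0
  set a := ‖M‖
  set b := ‖N‖
  have key : ∀ c : ℝ, |1 / (m : ℝ) * ∑ i, matInner (A i) (b • M + c • N) ^ 2
      - ‖b • M + c • N‖ ^ 2| ≤ δ * ‖b • M + c • N‖ ^ 2 := fun c => by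
    have hs : (b • M + c • N).IsSymm := (hM.smul b).add (hN.smul c)
    have hrk : (b • M + c • N).rank ≤ k := by
      exact (rank_add_le _ _).trans (le_trans (add_le_add (rank_smul_le _ _) (rank_smul_le _ _)) hr)
    obtain ⟨h1, h2⟩ := h _ hs hrk
    rw [abs_le]; constructor <;> linarith
  have expand : ∀ c : ℝ, 1 / (m : ℝ) * ∑ i, matInner (A i) (b • M + c • N) ^ 2
      = b ^ 2 * measInner A M M + 2 * b * c * measInner A M N + c ^ 2 * measInner A N N := by
    intro c
    simp only [measInner, matInner_add_right, matInner_smul_right, Finset.mul_sum,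
      ← Finset.sum_add_distrib]
    refine Finset.sum_congr rfl fun i _ => ?_
    ring
  have expand' : ∀ c : ℝ, ‖b • M + c • N‖ ^ 2
      = b ^ 2 * a ^ 2 + 2 * b * c * matInner M N + c ^ 2 * b ^ 2 := by
    intro c
    rw [← matInner_self, matInner_add_right, matInner_smul_right, matInner_smul_right,
      matInner_comm _ M, matInner_comm _ N, matInner_add_right, matInner_add_right,
      matInner_smul_right, matInner_smul_right, matInner_smul_right, matInner_smul_right,
      matInner_self, matInner_self, matInner_comm N M]
    ring
  have k1 := abs_le.1 (key a)
  have k2 := abs_le.1 (key (-a))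
  rw [expand, expand'] at k1 k2
  have hab : 0 < 4 * (a * b) := by positivity
  rw [abs_le]
  constructor
  · refine le_of_mul_le_mul_left ?_ hab
    nlinarith [k1.1, k2.2]
  · refine le_of_mul_le_mul_left ?_ hab
    nlinarith [k1.2, k2.1]

theorem inner_opOf_transpose (M : Matrix (Fin d) (Fin d) ℝ) (x y : EuclideanSpace ℝ (Fin d)) :
    ⟪opOf Mᵀ x, y⟫_ℝ = ⟪x, opOf M y⟫_ℝ := by
  rw [← ContinuousLinearMap.adjoint_inner_left, ← ContinuousLinearMap.star_eq_adjoint, ← map_star,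
    Matrix.star_eq_conjTranspose, Matrix.conjTranspose_eq_transpose_of_trivial]

/-- The squared Frobenius norm is the sum of the eigenvalues of `Nᵀ N`; at most `k` of them are
nonzero and each is at most `ξ²`. -/
theorem norm_sq_le_of_rank_le {N : Matrix (Fin d) (Fin d) ℝ} {k : ℕ} {ξ : ℝ}
    (hr : N.rank ≤ k) (hξ : ∀ x, ‖opOf N x‖ ≤ ξ * ‖x‖) : ‖N‖ ^ 2 ≤ k * ξ ^ 2 := by
  have hH : (Nᵀ * N).IsHermitian := by
    simpa using Matrix.isHermitian_conjTranspose_mul_self N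
  have h1 : ‖N‖ ^ 2 = ∑ i, hH.eigenvalues i := by
    rw [← matInner_self, matInner, hH.trace_eq_sum_eigenvalues]; simp
  have h2 : ∀ i, hH.eigenvalues i ≤ ξ ^ 2 := fun i => by
    have h3 := hH.mulVec_eigenvectorBasis i
    set v := hH.eigenvectorBasis i with hv
    have hvn : ‖v‖ = 1 := hH.eigenvectorBasis.orthonormal.1 i
    have h4 : opOf (Nᵀ * N) v = hH.eigenvalues i • v := by
      ext j
      exact congrFun h3 j
    have h5 : ⟪opOf (Nᵀ * N) v, v⟫_ℝ = ‖opOf N v‖ ^ 2 := by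
      rw [opOf, map_mul, ← real_inner_self_eq_norm_sq]
      exact inner_opOf_transpose N _ _
    rw [h4, inner_smul_left, real_inner_self_eq_norm_sq, hvn] at h5
    have h6 := hξ v
    rw [hvn, mul_one] at h6
    simp only [conj_trivial, one_pow, mul_one] at h5
    rw [h5]; gcongr
  have h3 : (Finset.univ.filter fun i => hH.eigenvalues i ≠ 0).card ≤ k := by
    rw [← Fintype.card_subtype, ← hH.rank_eq_card_non_zero_eigs, Matrix.rank_transpose_mul_self]
    exact hr
  rw [h1, ← Finset.sum_filter_ne_zero]
  calc _ ≤ (Finset.univ.filter fun i => hH.eigenvalues i ≠ 0).card • ξ ^ 2 :=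
        Finset.sum_le_card_nsmul _ _ _ fun i _ => h2 i
    _ ≤ _ := by rw [nsmul_eq_mul]; gcongr

theorem norm_sq_le_of_opNorm_le {N : Matrix (Fin d) (Fin d) ℝ} {ξ : ℝ}
    (hξ : ∀ x, ‖opOf N x‖ ≤ ξ * ‖x‖) : ‖N‖ ^ 2 ≤ d * ξ ^ 2 :=
  norm_sq_le_of_rank_le (N.rank_le_width) hξ

/-- The matrix of the orthogonal projection onto a subspace. -/
def projMatrix (S : Submodule ℝ (EuclideanSpace ℝ (Fin d))) : Matrix (Fin d) (Fin d) ℝ :=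
  (Matrix.toEuclideanCLM (𝕜 := ℝ)).symm S.starProjection

theorem opOf_projMatrix (S : Submodule ℝ (EuclideanSpace ℝ (Fin d))) :
    opOf (projMatrix S) = S.starProjection := by
  simp [projMatrix, opOf]

theorem opOf_injective : Function.Injective (opOf (d := d)) :=
  (Matrix.toEuclideanCLM (𝕜 := ℝ)).injective

theorem projMatrix_isSymm (S : Submodule ℝ (EuclideanSpace ℝ (Fin d))) :
    (projMatrix S).IsSymm := by
  apply opOf_injective
  ext1 x
  refine ext_inner_right ℝ fun y => ?_
  rw [inner_opOf_transpose, opOf_projMatrix, S.inner_starProjection_left_eq_right]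

theorem projMatrix_orthogonal (S : Submodule ℝ (EuclideanSpace ℝ (Fin d))) :
    projMatrix Sᗮ = 1 - projMatrix S := by
  apply opOf_injective
  rw [opOf_projMatrix, opOf, map_sub, map_one]
  change _ = 1 - opOf (projMatrix S)
  rw [opOf_projMatrix, S.starProjection_orthogonal']

theorem rank_projMatrix (S : Submodule ℝ (EuclideanSpace ℝ (Fin d))) :
    (projMatrix S).rank = Module.finrank ℝ S := by
  rw [rank_eq_finrank_opOf, opOf_projMatrix]
  exact congrArg (fun T : Submodule ℝ (EuclideanSpace ℝ (Fin d)) => Module.finrank ℝ T)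
    S.range_starProjection

/-- For symmetric `D` the quadratic form determines the norm: polarise at `‖D x‖ x ± ‖x‖ D x`. Hence
the error need only be tested on matrices `z zᵀ` of rank one. -/
theorem norm_le_of_abs_inner_self_le {E : Type*} [NormedAddCommGroup E] [InnerProductSpace ℝ E]
    {D : E →L[ℝ] E} {c : ℝ} (hc : 0 ≤ c) (hD : ∀ x y, ⟪D x, y⟫_ℝ = ⟪x, D y⟫_ℝ)
    (h : ∀ x, |⟪D x, x⟫_ℝ| ≤ c * ‖x‖ ^ 2) (x : E) : ‖D x‖ ≤ c * ‖x‖ := by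
  rcases eq_or_ne (D x) 0 with h0 | h0
  · rw [h0, norm_zero]; positivity
  have hx : x ≠ 0 := fun hx => h0 (by rw [hx, map_zero])
  have ha : 0 < ‖x‖ := norm_pos_iff.2 hx
  have hb : 0 < ‖D x‖ := norm_pos_iff.2 h0
  set a := ‖x‖ with had
  set b := ‖D x‖ with hbd
  have h1 := (abs_le.1 (h (b • x + a • D x))).2
  have h2 := (abs_le.1 (h (b • x - a • D x))).1
  have h3 : ‖b • x + a • D x‖ ^ 2 + ‖b • x - a • D x‖ ^ 2 = 4 * (a ^ 2 * b ^ 2) := by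
    rw [norm_add_sq_real, norm_sub_sq_real, norm_smul, norm_smul, ← had, ← hbd,
      Real.norm_of_nonneg ha.le, Real.norm_of_nonneg hb.le]; ring
  have h4 : ⟪D (b • x + a • D x), b • x + a • D x⟫_ℝ - ⟪D (b • x - a • D x), b • x - a • D x⟫_ℝ
      = 4 * (a * b * b ^ 2) := by
    simp only [map_add, map_sub, map_smul, inner_add_left, inner_add_right, inner_sub_left,
      inner_sub_right, inner_smul_left, inner_smul_right, conj_trivial, hD (D x) x,
      real_inner_self_eq_norm_sq, ← hbd]
    ring
  have h5 : a * b ^ 2 * b ≤ a * b ^ 2 * (c * a) := by nlinarith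
  exact le_of_mul_le_mul_left h5 (by positivity)

theorem opOf_mul (M N : Matrix (Fin d) (Fin d) ℝ) : opOf (M * N) = opOf M * opOf N := map_mul _ _ _

theorem opOf_sub (M N : Matrix (Fin d) (Fin d) ℝ) : opOf (M - N) = opOf M - opOf N := map_sub _ _ _

theorem inner_opOf_self (M : Matrix (Fin d) (Fin d) ℝ) (x : EuclideanSpace ℝ (Fin d)) :
    ⟪opOf M x, x⟫_ℝ = matInner M (Matrix.vecMulVec x x) := by
  rw [real_inner_comm, Matrix.inner_toEuclideanCLM, matInner_eq_sum]
  simp only [dotProduct, Matrix.mulVec, Matrix.vecMulVec_apply, Finset.mul_sum]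
  exact Finset.sum_congr rfl fun i _ => Finset.sum_congr rfl fun j _ => by ring

theorem norm_vecMulVec_self (x : Fin d → ℝ) : ‖Matrix.vecMulVec x x‖ = ∑ i, x i ^ 2 := by
  apply (sq_eq_sq₀ (norm_nonneg _) (Finset.sum_nonneg fun i _ => sq_nonneg _)).1
  rw [norm_sq_eq_sum, sq (∑ i, x i ^ 2), Finset.sum_mul_sum]
  simp only [Matrix.vecMulVec_apply, mul_pow]

theorem vecMulVec_self_isSymm (x : Fin d → ℝ) : (Matrix.vecMulVec x x).IsSymm := by
  ext i j; simp [Matrix.vecMulVec_apply, mul_comm]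

/-- The matrix of `lowRankPart`. -/
def lowRankMatrix (U X : Matrix (Fin d) (Fin d) ℝ) (S : Submodule ℝ (EuclideanSpace ℝ (Fin d))) :
    Matrix (Fin d) (Fin d) ℝ :=
  U * Uᵀ - X - (projMatrix Sᗮ * U) * (projMatrix Sᗮ * U)ᵀ

theorem opOf_lowRankMatrix (U X : Matrix (Fin d) (Fin d) ℝ)
    (S : Submodule ℝ (EuclideanSpace ℝ (Fin d))) :
    opOf (lowRankMatrix U X S) = lowRankPart (opOf (U * Uᵀ)) (opOf X) S := by
  rw [lowRankMatrix, lowRankPart, Matrix.transpose_mul, projMatrix_isSymm, ← opOf_projMatrix,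
    opOf_sub, opOf_sub]
  simp only [opOf_mul, mul_assoc]

theorem lowRankMatrix_isSymm {U X : Matrix (Fin d) (Fin d) ℝ} (hX : X.IsSymm)
    (S : Submodule ℝ (EuclideanSpace ℝ (Fin d))) : (lowRankMatrix U X S).IsSymm :=
  ((Matrix.isSymm_mul_transpose_self _).sub hX).sub (Matrix.isSymm_mul_transpose_self _)

/-- With `P` the projection to `S`, the matrix is `P G + (1 - P) G P - X`, three pieces of rank at
most `r`. -/
theorem rank_lowRankMatrix_le {U X : Matrix (Fin d) (Fin d) ℝ} {r : ℕ} (hXr : X.rank ≤ r)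
    {S : Submodule ℝ (EuclideanSpace ℝ (Fin d))} (hS : Module.finrank ℝ S ≤ r) :
    (lowRankMatrix U X S).rank ≤ 3 * r := by
  have h1 : lowRankMatrix U X S = projMatrix S * (U * Uᵀ)
      + ((1 - projMatrix S) * (U * Uᵀ) * projMatrix S + (-1 : ℝ) • X) := by
    rw [lowRankMatrix, Matrix.transpose_mul, projMatrix_isSymm, projMatrix_orthogonal]
    simp only [neg_smul, one_smul]
    noncomm_ring
  have h2 := rank_projMatrix S
  have h3 := (Matrix.rank_mul_le_left (projMatrix S) (U * Uᵀ))
  have h4 := (Matrix.rank_mul_le_right ((1 - projMatrix S) * (U * Uᵀ)) (projMatrix S))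
  have h5 := rank_smul_le (-1) X
  rw [h1]
  have h6 := rank_add_le (projMatrix S * (U * Uᵀ))
    ((1 - projMatrix S) * (U * Uᵀ) * projMatrix S + (-1 : ℝ) • X)
  have h7 := rank_add_le ((1 - projMatrix S) * (U * Uᵀ) * projMatrix S) ((-1 : ℝ) • X)
  omega

theorem norm_sq_noise_le {U : Matrix (Fin d) (Fin d) ℝ}
    {S : Submodule ℝ (EuclideanSpace ℝ (Fin d))} {e : ℝ}
    (hn : ∀ k ∈ Sᗮ, ‖opOf Uᵀ k‖ ≤ e * ‖k‖) (he : 0 ≤ e) :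
    ‖projMatrix Sᗮ * U‖ ^ 2 ≤ d * e ^ 2 := by
  rw [← Matrix.frobenius_norm_transpose]
  refine norm_sq_le_of_opNorm_le fun x => ?_
  rw [Matrix.transpose_mul, projMatrix_isSymm, opOf_mul, opOf_projMatrix]
  refine (hn _ (Sᗮ.starProjection_apply_mem x)).trans ?_
  gcongr
  exact Sᗮ.norm_starProjection_apply_le x

theorem norm_lowRankMatrix_le {U X : Matrix (Fin d) (Fin d) ℝ} {r : ℕ} (hXr : X.rank ≤ r)
    {S : Submodule ℝ (EuclideanSpace ℝ (Fin d))} (hS : Module.finrank ℝ S ≤ r) {ξ : ℝ}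
    (hξ : ∀ x, ‖lowRankPart (opOf (U * Uᵀ)) (opOf X) S x‖ ≤ ξ * ‖x‖) :
    ‖lowRankMatrix U X S‖ ^ 2 ≤ 3 * r * ξ ^ 2 := by
  rw [← opOf_lowRankMatrix] at hξ
  have := norm_sq_le_of_rank_le (rank_lowRankMatrix_le (U := U) hXr hS) hξ
  push_cast at this
  exact this

/-- The Frobenius distance in terms of a splitting. -/
theorem norm_sq_sub_le {U X : Matrix (Fin d) (Fin d) ℝ} {r : ℕ} (hXr : X.rank ≤ r)
    {S : Submodule ℝ (EuclideanSpace ℝ (Fin d))} (hS : Module.finrank ℝ S ≤ r) {e ξ : ℝ}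
    (hn : ∀ k ∈ Sᗮ, ‖opOf Uᵀ k‖ ≤ e * ‖k‖) (he : 0 ≤ e)
    (hξ : ∀ x, ‖lowRankPart (opOf (U * Uᵀ)) (opOf X) S x‖ ≤ ξ * ‖x‖) :
    ‖U * Uᵀ - X‖ ^ 2 ≤ 6 * r * ξ ^ 2 + 2 * (d * e ^ 2) ^ 2 := by
  have h1 := norm_lowRankMatrix_le hXr hS hξ
  have h2 := norm_sq_noise_le hn he
  set N := projMatrix Sᗮ * U
  have h3 : ‖N * Nᵀ‖ ≤ ‖N‖ ^ 2 := by
    refine (Matrix.frobenius_norm_mul _ _).trans (le_of_eq ?_)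
    rw [Matrix.frobenius_norm_transpose, sq]
  have h4 : ‖N * Nᵀ‖ ^ 2 ≤ (d * e ^ 2) ^ 2 := by gcongr; exact h3.trans h2
  have h5 : U * Uᵀ - X = lowRankMatrix U X S + N * Nᵀ := by rw [lowRankMatrix]; abel
  have h6 : ‖U * Uᵀ - X‖ ≤ ‖lowRankMatrix U X S‖ + ‖N * Nᵀ‖ := by rw [h5]; exact norm_add_le _ _
  have h7 : ‖U * Uᵀ - X‖ ^ 2 ≤ (‖lowRankMatrix U X S‖ + ‖N * Nᵀ‖) ^ 2 := by gcongr
  nlinarith [sq_nonneg (‖lowRankMatrix U X S‖ - ‖N * Nᵀ‖)]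

theorem measInner_add_left (A : Fin m → Matrix (Fin d) (Fin d) ℝ)
    (M N P : Matrix (Fin d) (Fin d) ℝ) :
    measInner A (M + N) P = measInner A M P + measInner A N P := by
  simp only [measInner, matInner_add_right, add_mul, Finset.sum_add_distrib, mul_add]

theorem measInner_sum_left {ι : Type*} (t : Finset ι) (A : Fin m → Matrix (Fin d) (Fin d) ℝ)
    (M : ι → Matrix (Fin d) (Fin d) ℝ) (P : Matrix (Fin d) (Fin d) ℝ) :
    measInner A (∑ i ∈ t, M i) P = ∑ i ∈ t, measInner A (M i) P := by
  simp only [measInner, matInner_sum_right, Finset.sum_mul]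
  rw [Finset.sum_comm, Finset.mul_sum]

/-- The error operator is controlled through every splitting into a low-rank part and a small
remainder. -/
theorem RIP.error_norm_le {A : Fin m → Matrix (Fin d) (Fin d) ℝ} {r : ℕ} {δ : ℝ}
    (h : RIP A (4 * r) δ) (hr : 1 ≤ r) (hδ : 0 ≤ δ) (hA : ∀ i, (A i).IsSymm)
    {X U : Matrix (Fin d) (Fin d) ℝ} (hX : X.IsSymm) (hXr : X.rank = r)
    {S : Submodule ℝ (EuclideanSpace ℝ (Fin d))} (hS : Module.finrank ℝ S ≤ r) {e ξ : ℝ}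
    (hξ0 : 0 ≤ ξ) (hn : ∀ k ∈ Sᗮ, ‖opOf Uᵀ k‖ ≤ e * ‖k‖) (he : 0 ≤ e)
    (hξ : ∀ x, ‖lowRankPart (opOf (U * Uᵀ)) (opOf X) S x‖ ≤ ξ * ‖x‖)
    (x : EuclideanSpace ℝ (Fin d)) :
    ‖opOf ((1 / (m : ℝ)) • ∑ i, matInner (A i) (U * Uᵀ - X) • A i - (U * Uᵀ - X)) x‖
      ≤ δ * (√(3 * r) * ξ + d * e ^ 2) * ‖x‖ := by
  set R := U * Uᵀ - X with hR
  set Dm := (1 / (m : ℝ)) • ∑ i, matInner (A i) R • A i - R with hDm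
  have hRs : R.IsSymm := (Matrix.isSymm_mul_transpose_self _).sub hX
  have hDs : Dm.IsSymm := by
    refine Matrix.IsSymm.sub (Matrix.IsSymm.smul ?_ _) hRs
    rw [Matrix.IsSymm, Matrix.transpose_sum]
    exact Finset.sum_congr rfl fun i _ => (hA i).smul _
  have hl := norm_lowRankMatrix_le hXr.le hS hξ
  have hN := norm_sq_noise_le hn he
  set L := lowRankMatrix U X S with hL
  set N := projMatrix Sᗮ * U with hNd
  -- The remainder `N Nᵀ` may have large rank, so it is written as a sum over the columns of `N`,
  -- each term being within reach of the isometry property; their Frobenius norms add up to `‖N‖²`.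
  have hRL : R = L + ∑ j, Matrix.vecMulVec (fun i => N i j) (fun i => N i j) := by
    have : N * Nᵀ = ∑ j, Matrix.vecMulVec (fun i => N i j) (fun i => N i j) := by
      ext a b
      simp [Matrix.mul_apply, Matrix.sum_apply, Matrix.vecMulVec_apply]
    rw [← this, hL, lowRankMatrix, ← hNd, hR]; abel
  have hL' : ‖L‖ ≤ √(3 * r) * ξ := by
    apply abs_le_of_sq_le_sq' _ (by positivity) |>.2
    rw [mul_pow, Real.sq_sqrt (by positivity)]; exact hl
  refine norm_le_of_abs_inner_self_le (by positivity) (fun a b => ?_) (fun z => ?_) x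
  · rw [← inner_opOf_transpose, hDs]
  · set Z := Matrix.vecMulVec z z with hZ
    have hZs : Z.IsSymm := vecMulVec_self_isSymm _
    have hZr : Z.rank ≤ 1 := Matrix.rank_vecMulVec_le _ _
    have hZn : ‖Z‖ = ‖z‖ ^ 2 := by
      rw [hZ, norm_vecMulVec_self, EuclideanSpace.norm_sq_eq]; simp
    have h1 : ⟪opOf Dm z, z⟫_ℝ = measInner A R Z - matInner R Z := by
      rw [inner_opOf_self, matInner_comm, hDm, matInner_sub_right, matInner_smul_right,
        matInner_sum_right, measInner, matInner_comm Z R]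
      congr 2
      refine Finset.sum_congr rfl fun i _ => ?_
      rw [matInner_smul_right, matInner_comm Z]
    have h2 : measInner A R Z - matInner R Z = (measInner A L Z - matInner L Z)
        + ∑ j, (measInner A (Matrix.vecMulVec (fun i => N i j) (fun i => N i j)) Z
          - matInner (Matrix.vecMulVec (fun i => N i j) (fun i => N i j)) Z) := by
      rw [Finset.sum_sub_distrib, ← measInner_sum_left, hRL, measInner_add_left, matInner_comm,
        matInner_add_right, matInner_sum_right, matInner_comm Z L]
      simp only [matInner_comm Z]
      ring
    -- The ranks add up to at most `3r + 1 ≤ 4r`.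
    have h3 : |measInner A L Z - matInner L Z| ≤ δ * ‖L‖ * ‖Z‖ :=
      h.bilinear (lowRankMatrix_isSymm hX S) hZs
        (by have := rank_lowRankMatrix_le (U := U) hXr.le hS; rw [← hL] at this; omega)
    have h4 : ∀ j, |measInner A (Matrix.vecMulVec (fun i => N i j) (fun i => N i j)) Z
          - matInner (Matrix.vecMulVec (fun i => N i j) (fun i => N i j)) Z|
          ≤ δ * (∑ i, N i j ^ 2) * ‖Z‖ := fun j => by
      rw [← norm_vecMulVec_self]
      refine h.bilinear (vecMulVec_self_isSymm _) hZs ?_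
      have := Matrix.rank_vecMulVec_le (fun i => N i j) (fun i => N i j)
      omega
    have h5 : ∑ j, δ * (∑ i, N i j ^ 2) * ‖Z‖ = δ * ‖N‖ ^ 2 * ‖Z‖ := by
      rw [norm_sq_eq_sum, Finset.sum_comm, Finset.mul_sum, Finset.sum_mul]
    rw [h1, h2, ← hZn]
    refine (abs_add_le _ _).trans ?_
    have h6 := (Finset.abs_sum_le_sum_abs (fun j =>
      measInner A (Matrix.vecMulVec (fun i => N i j) (fun i => N i j)) Z
        - matInner (Matrix.vecMulVec (fun i => N i j) (fun i => N i j)) Z) Finset.univ).trans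
      (Finset.sum_le_sum fun j _ => h4 j)
    rw [h5] at h6
    calc _ ≤ δ * ‖L‖ * ‖Z‖ + δ * ‖N‖ ^ 2 * ‖Z‖ := add_le_add h3 h6
      _ = δ * (‖L‖ + ‖N‖ ^ 2) * ‖Z‖ := by ring
      _ ≤ _ := by gcongr

end

/-! ### The gradient, the spectrum of the target, and gradient descent as a trajectory. -/

section

variable {d m : ℕ}

theorem matInner_single (M : Matrix (Fin d) (Fin d) ℝ) (i j : Fin d) :
    matInner M (Matrix.single i j 1) = M i j := by
  rw [matInner_eq_sum, Finset.sum_eq_single i, Finset.sum_eq_single j]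
  · simp
  · intro b _ hb; simp [hb.symm]
  · simp
  · intro b _ hb; simp [hb.symm]
  · simp

theorem matInner_gram_line {A : Matrix (Fin d) (Fin d) ℝ} (hA : A.IsSymm)
    (U H : Matrix (Fin d) (Fin d) ℝ) (t : ℝ) :
    matInner A ((U + t • H) * (U + t • H)ᵀ)
      = matInner A (U * Uᵀ) + 2 * t * matInner (A * U) H + t ^ 2 * matInner A (H * Hᵀ) := by
  have h1 : matInner A (H * Uᵀ) = matInner (A * U) H := by
    rw [matInner, matInner, Matrix.transpose_mul, ← Matrix.mul_assoc, Matrix.trace_mul_comm,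
      Matrix.mul_assoc]
  have h2 : matInner A (U * Hᵀ) = matInner (A * U) H := by
    rw [← h1, matInner, matInner, ← Matrix.trace_transpose, Matrix.transpose_mul,
      Matrix.transpose_mul, Matrix.transpose_transpose, Matrix.transpose_transpose,
      Matrix.trace_mul_comm, hA]
  have h3 : (U + t • H) * (U + t • H)ᵀ = U * Uᵀ + t • (H * Uᵀ) + t • (U * Hᵀ)
      + t ^ 2 • (H * Hᵀ) := by
    simp only [Matrix.transpose_add, Matrix.transpose_smul, add_mul, mul_add, Matrix.smul_mul,
      Matrix.mul_smul, smul_smul, sq]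
    abel
  rw [h3]
  simp only [matInner_add_right, matInner_smul_right, h1, h2]
  ring

/-- Along a line the prediction is quadratic with linear coefficient `2 ⟨A U, H⟩`. This factor 2 is
what doubles the step size in the abstract dynamics. -/
theorem matGradient_loss {A : Fin m → Matrix (Fin d) (Fin d) ℝ} (hA : ∀ i, (A i).IsSymm)
    {X : Matrix (Fin d) (Fin d) ℝ} {y : Fin m → ℝ} (hy : ∀ i, y i = matInner (A i) X)
    (U : Matrix (Fin d) (Fin d) ℝ) :
    matGradient (loss A y) U
      = (2 : ℝ) • (((1 / (m : ℝ)) • ∑ k, matInner (A k) (U * Uᵀ - X) • A k) * U) := by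
  ext i j
  set H := Matrix.single i j (1 : ℝ) with hH
  have h1 : ∀ t : ℝ, loss A y (U + t • H) = 1 / (2 * (m : ℝ)) * ∑ k,
      (matInner (A k) (X - U * Uᵀ) - (2 * t * matInner (A k * U) H
        + t ^ 2 * matInner (A k) (H * Hᵀ))) ^ 2 := fun t => by
    rw [loss]
    congr 1
    refine Finset.sum_congr rfl fun k _ => ?_
    rw [matInner_gram_line (hA k), hy, matInner_sub_right]; ring
  have h2 : HasDerivAt (fun t : ℝ => loss A y (U + t • H))
      (1 / (2 * (m : ℝ)) * ∑ k, (2 * matInner (A k) (X - U * Uᵀ) *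
        (-(2 * matInner (A k * U) H)))) 0 := by
    simp only [h1]
    refine HasDerivAt.const_mul _ (HasDerivAt.fun_sum fun k _ => ?_)
    have h3 : HasDerivAt (fun t : ℝ => matInner (A k) (X - U * Uᵀ) - (2 * t * matInner (A k * U) H
        + t ^ 2 * matInner (A k) (H * Hᵀ))) (-(2 * matInner (A k * U) H)) 0 := by
      have ha : HasDerivAt (fun t : ℝ => 2 * t * matInner (A k * U) H)
          (2 * 1 * matInner (A k * U) H) 0 := ((hasDerivAt_id 0).const_mul 2).mul_const _
      have hb : HasDerivAt (fun t : ℝ => t ^ 2 * matInner (A k) (H * Hᵀ)) _ 0 :=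
        (hasDerivAt_pow 2 (0 : ℝ)).mul_const _
      convert! (ha.add hb).const_sub (matInner (A k) (X - U * Uᵀ)) using 1
      simp
    convert! h3.fun_pow 2 using 1
    simp
  rw [matGradient, Matrix.of_apply, h2.deriv]
  simp only [hH, matInner_single]
  simp only [Matrix.smul_apply, Matrix.smul_mul, Matrix.sum_mul, Matrix.sum_apply, smul_eq_mul,
    Finset.mul_sum]
  refine Finset.sum_congr rfl fun k _ => ?_
  rw [matInner_sub_right, matInner_sub_right]
  rcases eq_or_ne (m : ℝ) 0 with hm | hm
  · simp [hm]
  · field_simp; ring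

/-- The range of a matrix as a subspace of Euclidean space. -/
abbrev rangeOf (X : Matrix (Fin d) (Fin d) ℝ) : Submodule ℝ (EuclideanSpace ℝ (Fin d)) :=
  LinearMap.range (opOf X : EuclideanSpace ℝ (Fin d) →ₗ[ℝ] EuclideanSpace ℝ (Fin d))

/-- A positive eigenvalue is a singular value of some index `i < rank X` counted from 0, and
singular values decrease up to index `rank X - 1`, the one that `sigma` picks. -/
theorem sigma_le_of_eigenvalue {X : Matrix (Fin d) (Fin d) ℝ} (hX : X.PosSemidef) {l : ℝ}
    (hl : 0 < l) {v : EuclideanSpace ℝ (Fin d)} (hv : v ≠ 0) (hXv : opOf X v = l • v) :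
    sigma X.rank X ≤ l := by
  set T := Matrix.toEuclideanLin (𝕜 := ℝ) X with hT
  have hTv : T v = l • v := hXv
  have hadj : LinearMap.adjoint T = T := by
    rw [hT, ← Matrix.toEuclideanLin_conjTranspose_eq_adjoint, hX.isHermitian]
  have hev : Module.End.HasEigenvalue (LinearMap.adjoint T ∘ₗ T) (l ^ 2) := by
    refine Module.End.hasEigenvalue_of_hasEigenvector (x := v) ⟨?_, hv⟩
    rw [Module.End.mem_eigenspace_iff, hadj, LinearMap.comp_apply, hTv, map_smul, hTv,
      smul_smul, sq]
  obtain ⟨i, hi⟩ := T.isSymmetric_adjoint_comp_self.exists_eigenvalues_eq rfl hev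
  have h1 : T.singularValues i ^ 2 = l ^ 2 := by
    rw [T.sq_singularValues_fin rfl]; exact_mod_cast hi
  have h2 : T.singularValues i = l :=
    (sq_eq_sq₀ (T.singularValues_nonneg _) hl.le).1 h1
  have h3 : (i : ℕ) < Module.finrank ℝ (LinearMap.range T) :=
    T.singularValues_pos_iff_lt_finrank_range.1 (by rw [h2]; exact hl)
  have h4 : X.rank = Module.finrank ℝ (LinearMap.range T) := rank_eq_finrank_opOf X
  rw [sigma, ← h2]
  exact T.singularValues_antitone (by omega)

theorem sigma_rank_pos {X : Matrix (Fin d) (Fin d) ℝ} (hr : 1 ≤ X.rank) : 0 < sigma X.rank X := by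
  have h4 : X.rank = Module.finrank ℝ (LinearMap.range (Matrix.toEuclideanLin (𝕜 := ℝ) X)) :=
    rank_eq_finrank_opOf X
  exact LinearMap.singularValues_pos_iff_lt_finrank_range _ |>.2 (by omega)

theorem isTarget_opOf {X : Matrix (Fin d) (Fin d) ℝ} (hX : X.PosSemidef) (h1 : specNorm X = 1) :
    IsTarget (opOf X) (rangeOf X) (sigma X.rank X) := by
  have hsym : Xᵀ = X := by
    have := hX.isHermitian
    rwa [Matrix.IsHermitian, Matrix.conjTranspose_eq_transpose_of_trivial] at this
  have hsymm : ∀ x y, ⟪opOf X x, y⟫_ℝ = ⟪x, opOf X y⟫_ℝ := fun x y => by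
    rw [← inner_opOf_transpose, hsym]
  refine ⟨hsymm, fun x => ⟨x, rfl⟩, fun x => ?_, ?_⟩
  · have := (opOf X).le_opNorm x
    rwa [show ‖opOf X‖ = 1 from h1, one_mul] at this
  · rintro v ⟨w, rfl⟩
    have hS : (Matrix.toEuclideanLin (𝕜 := ℝ) X).IsSymmetric := hsymm
    have hn : Module.finrank ℝ (EuclideanSpace ℝ (Fin d)) = d := by simp
    set b := hS.eigenvectorBasis hn with hb
    set l := hS.eigenvalues hn with hl
    have hbl : ∀ i, opOf X (b i) = l i • b i := fun i => by
      have := hS.apply_eigenvectorBasis hn i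
      exact_mod_cast this
    simp only [ContinuousLinearMap.coe_coe]
    set v := opOf X w with hv
    have hvb : ∀ i, ⟪b i, v⟫_ℝ = l i * ⟪b i, w⟫_ℝ := fun i => by
      rw [hv, ← hsymm, hbl, inner_smul_left]; rfl
    have hl0 : ∀ i, 0 ≤ l i := fun i => by
      have h2 := hX.dotProduct_mulVec_nonneg (b i)
      have h3 : ⟪b i, opOf X (b i)⟫_ℝ = l i := by
        rw [hbl, inner_smul_right, real_inner_self_eq_norm_sq, b.orthonormal.1 i]; simp
      rw [← h3, Matrix.inner_toEuclideanCLM]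
      simpa using h2
    have e1 : ‖v‖ ^ 2 = ∑ i, ⟪b i, v⟫_ℝ ^ 2 := by
      rw [← real_inner_self_eq_norm_sq, ← b.sum_inner_mul_inner v v]
      exact Finset.sum_congr rfl fun i _ => by rw [real_inner_comm, sq]
    have e2 : ⟪v, opOf X v⟫_ℝ = ∑ i, l i * ⟪b i, v⟫_ℝ ^ 2 := by
      rw [← b.sum_inner_mul_inner v (opOf X v)]
      refine Finset.sum_congr rfl fun i _ => ?_
      rw [← hsymm (b i) v, hbl, inner_smul_left, real_inner_comm (b i) v]
      simp only [conj_trivial]; ring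
    rw [e1, e2, Finset.mul_sum]
    refine Finset.sum_le_sum fun i _ => ?_
    -- A vector of the range has no coefficient along the kernel, so only positive eigenvalues
    -- contribute.
    rcases (hl0 i).eq_or_lt with h0 | h0
    · rw [hvb, ← h0]; simp
    · have := sigma_le_of_eigenvalue hX h0 (b.orthonormal.ne_zero i) (hbl i)
      gcongr

theorem sigma_rank_le_one {X : Matrix (Fin d) (Fin d) ℝ} (hX : X.PosSemidef)
    (h1 : specNorm X = 1) : sigma X.rank X ≤ 1 := by
  have ht := isTarget_opOf hX h1
  have hX0 : opOf X ≠ 0 := fun h => by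
    have : ‖opOf X‖ = 1 := h1
    rw [h, norm_zero] at this; norm_num at this
  obtain ⟨w, hw⟩ : ∃ w, opOf X w ≠ 0 := by
    by_contra! h; exact hX0 (ContinuousLinearMap.ext h)
  have h2 := ht.lower _ (ht.mem w)
  have h3 := real_inner_le_norm (opOf X w) (opOf X (opOf X w))
  have h4 := ht.norm_le (opOf X w)
  have h5 : 0 < ‖opOf X w‖ := norm_pos_iff.2 hw
  have h6 : sigma X.rank X * ‖opOf X w‖ ^ 2 ≤ 1 * ‖opOf X w‖ ^ 2 := by nlinarith
  exact le_of_mul_le_mul_right h6 (by positivity)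

theorem rank_pos_of_specNorm {X : Matrix (Fin d) (Fin d) ℝ} (h1 : specNorm X = 1) :
    1 ≤ X.rank := by
  by_contra! h
  have h0 : X.rank = 0 := by omega
  rw [rank_eq_finrank_opOf, Submodule.finrank_eq_zero, LinearMap.range_eq_bot] at h0
  have : opOf X = 0 := by ext1 x; exact LinearMap.congr_fun h0 x
  have h2 : ‖opOf X‖ = 1 := h1
  rw [this, norm_zero] at h2; norm_num at h2

/-- Gradient descent from a scaled orthogonal matrix is a trajectory in the sense of
`IsTrajectory`, with step size `2 η`. -/
theorem isTrajectory_gradientDescent {A : Fin m → Matrix (Fin d) (Fin d) ℝ} {r : ℕ}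
    {X B : Matrix (Fin d) (Fin d) ℝ} {y : Fin m → ℝ} {δ α η : ℝ} (hX : X.PosSemidef)
    (hXr : X.rank = r) (h1 : specNorm X = 1) (hA : ∀ i, (A i).IsSymm)
    (hy : ∀ i, y i = matInner (A i) X) (hrip : RIP A (4 * r) δ) (hδ : 0 ≤ δ)
    (hB : B ∈ Matrix.orthogonalGroup (Fin d) ℝ) (hα : 0 < α) :
    let U := gradientDescent (loss A y) η (α • B)
    IsTrajectory (opOf X) (rangeOf X) (sigma X.rank X) (2 * η) δ α r d
      (fun t => opOf (U t * (U t)ᵀ)) (fun t => opOf (U t)ᵀ)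
      (fun t => opOf ((1 / (m : ℝ)) • ∑ i, matInner (A i) (U t * (U t)ᵀ - X) • A i
        - (U t * (U t)ᵀ - X))) := by
  intro U
  have hsym : X.IsSymm := by
    have := hX.isHermitian
    rwa [Matrix.IsHermitian, Matrix.conjTranspose_eq_transpose_of_trivial] at this
  have hr : 1 ≤ r := hXr ▸ rank_pos_of_specNorm h1
  set K : ℕ → Matrix (Fin d) (Fin d) ℝ :=
    fun t => (1 / (m : ℝ)) • ∑ i, matInner (A i) (U t * (U t)ᵀ - X) • A i with hK
  have hKs : ∀ t, (K t)ᵀ = K t := fun t => by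
    simp only [hK, Matrix.transpose_smul, Matrix.transpose_sum]
    congr 1
    exact Finset.sum_congr rfl fun i _ => by rw [(hA i).eq]
  have hU : ∀ t, U (t + 1) = (1 - (2 * η) • K t) * U t := fun t => by
    change U t - η • matGradient (loss A y) (U t) = _
    rw [matGradient_loss hA hy]
    simp only [hK, sub_mul, one_mul, Matrix.smul_mul, smul_smul]
    congr 2; ring
  have hM : ∀ t, opOf (U t * (U t)ᵀ) - opOf X + opOf (K t - (U t * (U t)ᵀ - X)) = opOf (K t) :=
    fun t => by
      rw [opOf_sub, opOf_sub]; abel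
  have hstep : ∀ t, opOf (1 - (2 * η) • K t) = 1 - (2 * η) • opOf (K t) := fun t => by
    rw [opOf_sub]
    congr 1
    · exact map_one _
    · exact map_smul (Matrix.toEuclideanCLM (𝕜 := ℝ)) _ _
  have hstepT : ∀ t, (1 - (2 * η) • K t)ᵀ = 1 - (2 * η) • K t := fun t => by
    rw [Matrix.transpose_sub, Matrix.transpose_one, Matrix.transpose_smul, hKs]
  refine ⟨isTarget_opOf hX h1, fun t x z => ?_, fun x => ?_, fun t => ?_, fun t => ?_, ?_,
    fun t x z => ?_, ?_⟩
  · rw [opOf_mul]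
    have := inner_opOf_transpose (U t)ᵀ ((opOf (U t)ᵀ) x) z
    rw [Matrix.transpose_transpose] at this
    exact this
  · have hB' : B * Bᵀ = 1 := by
      have := (Matrix.mem_orthogonalGroup_iff (Fin d) ℝ).1 hB
      exact this
    have hW : opOf (U 0)ᵀ x = α • opOf Bᵀ x := by
      have : (U 0)ᵀ = α • Bᵀ := by
        change (α • B)ᵀ = _
        rw [Matrix.transpose_smul]
      rw [this]
      have := map_smul (Matrix.toEuclideanCLM (𝕜 := ℝ)) α Bᵀ
      rw [opOf, this]; rfl
    have h3 : ‖opOf Bᵀ x‖ = ‖x‖ := by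
      apply (sq_eq_sq₀ (norm_nonneg _) (norm_nonneg _)).1
      rw [← real_inner_self_eq_norm_sq, inner_opOf_transpose, ← real_inner_self_eq_norm_sq]
      have : opOf B (opOf Bᵀ x) = opOf (B * Bᵀ) x := by rw [opOf_mul]; rfl
      rw [this, hB']
      have : opOf (1 : Matrix (Fin d) (Fin d) ℝ) = 1 := map_one _
      rw [this]; rfl
    rw [hW, norm_smul, Real.norm_of_nonneg hα.le, h3]
  · change opOf (U (t + 1) * (U (t + 1))ᵀ)
      = (1 - (2 * η) • (opOf (U t * (U t)ᵀ) - opOf X + opOf (K t - (U t * (U t)ᵀ - X))))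
        * opOf (U t * (U t)ᵀ)
        * (1 - (2 * η) • (opOf (U t * (U t)ᵀ) - opOf X + opOf (K t - (U t * (U t)ᵀ - X))))
    rw [hM, hU, Matrix.transpose_mul, hstepT, ← hstep, ← opOf_mul, ← opOf_mul]
    simp only [Matrix.mul_assoc]
  · change opOf (U (t + 1))ᵀ = opOf (U t)ᵀ
        * (1 - (2 * η) • (opOf (U t * (U t)ᵀ) - opOf X + opOf (K t - (U t * (U t)ᵀ - X))))
    rw [hM, hU, Matrix.transpose_mul, hstepT, ← hstep, ← opOf_mul]
  · rw [← hXr, rank_eq_finrank_opOf]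
  · rw [← inner_opOf_transpose]
    congr 3
    rw [Matrix.transpose_sub]
    change K t - _ = (K t)ᵀ - _
    rw [hKs, Matrix.transpose_sub, hsym, Matrix.transpose_mul, Matrix.transpose_transpose]
  · intro t S e ξ hS he hξ0 hn hξ x
    exact hrip.error_norm_le hr hδ hA hsym hXr hS hξ0 hn he hξ x

end

/-! ### Choice of the phases and of the noise radius, and the final estimate. -/

section

variable {d m : ℕ}

/-- A time horizon of length at least `1000 log (D / α)` splits into a growth phase, in which the
noise grows by at most a factor `3 (D / α) ^ (1 / 8)`, and a contraction phase. -/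
theorem exists_phase_split {D α x : ℝ} (hα : 0 < α) (hD : 0 < D) (hL : 1 ≤ Real.log (D / α))
    (hx : 0 < x) (hx1 : x ≤ 1) {T : ℕ} (hT : 1000 * Real.log (D / α) ≤ x * T) :
    ∃ t n : ℕ, t + n = T ∧ (1 + x / 4000) ^ t ≤ 3 * Real.exp (Real.log (D / α) / 8) ∧
      D / α ≤ (1 + x / 10) ^ t ∧ (1 - x / 200) ^ n ≤ (α / D) ^ 2 := by
  set L := Real.log (D / α) with hLdef
  have hDα : Real.exp L = D / α := Real.exp_log (by positivity)
  -- Then `x t` lies in `[500 L, 500 L + 1]`: the noise exponent `x t / 4000` is about `L / 8`, the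
  -- signal exponent is at least `25 L`, and the remaining `x n ≥ 500 L - 1` steps suffice for the
  -- contraction `exp (-2L)`.
  set t := ⌈500 * L / x⌉₊ with ht
  have ht1 : 500 * L ≤ x * t := by
    have := Nat.le_ceil (500 * L / x)
    rw [div_le_iff₀ hx] at this; linarith
  have ht2 : x * t ≤ 500 * L + 1 := by
    have := (Nat.ceil_lt_add_one (a := 500 * L / x) (by positivity)).le
    calc x * t ≤ x * (500 * L / x + 1) := by gcongr
      _ = 500 * L + x := by field_simp
      _ ≤ _ := by linarith
  have htT : t ≤ T := by
    have : x * t ≤ x * T := by linarith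
    exact_mod_cast le_of_mul_le_mul_left this hx
  refine ⟨t, T - t, by omega, ?_, ?_, ?_⟩
  · calc (1 + x / 4000) ^ t ≤ Real.exp (x / 4000) ^ t := by
          gcongr; linarith [Real.add_one_le_exp (x / 4000)]
      _ = Real.exp (t * (x / 4000)) := (Real.exp_nat_mul _ _).symm
      _ ≤ Real.exp (1 + L / 8) := Real.exp_le_exp.2 (by linarith)
      _ = Real.exp 1 * Real.exp (L / 8) := Real.exp_add _ _
      _ ≤ _ := by gcongr; linarith [Real.exp_one_lt_d9]
  · have h1 : Real.exp (x / 20) ≤ 1 + x / 10 := by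
      have h2 : 1 - x / 20 ≤ Real.exp (-(x / 20)) := by linarith [Real.add_one_le_exp (-(x / 20))]
      have h3 : Real.exp (-(x / 20)) * Real.exp (x / 20) = 1 := by
        rw [← Real.exp_add]; simp
      have h4 := Real.exp_pos (x / 20)
      have h5 : (1 - x / 20) * Real.exp (x / 20) ≤ 1 :=
      (mul_le_mul_of_nonneg_right h2 h4.le).trans h3.le
      by_contra! h6
      nlinarith [mul_lt_mul_of_pos_left h6 (by linarith : 0 < 1 - x / 20)]
    calc D / α = Real.exp L := hDα.symm
      _ ≤ Real.exp (t * (x / 20)) := Real.exp_le_exp.2 (by linarith)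
      _ = Real.exp (x / 20) ^ t := Real.exp_nat_mul _ _
      _ ≤ _ := by gcongr
  · have hn : ((T - t : ℕ) : ℝ) = T - t := by push_cast [htT]; ring
    calc (1 - x / 200) ^ (T - t) ≤ Real.exp (-(x / 200)) ^ (T - t) := by
          gcongr
          · linarith
          · linarith [Real.add_one_le_exp (-(x / 200))]
      _ = Real.exp ((T - t : ℕ) * (-(x / 200))) := (Real.exp_nat_mul _ _).symm
      _ ≤ Real.exp ((2 : ℕ) * -L) := Real.exp_le_exp.2 (by rw [hn]; push_cast; nlinarith)
      _ = (α / D) ^ 2 := by rw [Real.exp_nat_mul, Real.exp_neg, hDα, inv_div]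

/-- Bounds for the noise radius `9 a² g`, where `a² = α`, `a g⁴ = √d` and `b² = σ`. -/
theorem noise_radius_bounds {a g b : ℝ} (ha : 0 < a) (hg : 1 ≤ g) (hag : 1 ≤ a * g ^ 4)
    (hb : 0 < b) (hb1 : b ≤ 1) (h : (a * g ^ 2) ^ 2 ≤ b ^ 3 / 6400) :
    9 * a ^ 2 * g ≤ b ^ 4 / 48000 ∧
      (a * g ^ 4) ^ 2 * (9 * a ^ 2 * g) ^ 2 ≤ a ^ 3 * g ^ 4 * b ^ 4 ∧
      a ^ 3 * g ^ 4 * b ^ 4 ≤ 1 ∧ 9 * a ^ 2 * g ≤ 9 * (a * g ^ 2) ^ 2 := by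
  have hu : 0 < a * g ^ 2 := by positivity
  have h1 : a * g ^ 2 ≤ b / 80 := by
    apply le_of_sq_le_sq _ (by positivity)
    have : b ^ 3 ≤ b ^ 2 := pow_le_pow_of_le_one hb.le hb1 (by norm_num)
    nlinarith
  have h3 : (a * g ^ 2) ^ 3 ≤ b ^ 4 / 512000 := by
    calc (a * g ^ 2) ^ 3 = (a * g ^ 2) ^ 2 * (a * g ^ 2) := by ring
      _ ≤ b ^ 3 / 6400 * (b / 80) := by gcongr
      _ = _ := by ring
  have hb4 : b ^ 4 ≤ 1 := pow_le_one₀ hb.le hb1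
  refine ⟨?_, ?_, ?_, ?_⟩
  · have : a ^ 2 * g * 1 ≤ a ^ 2 * g * (a * g ^ 4 * g) := by
      gcongr; nlinarith
    have h4 : a ^ 2 * g * (a * g ^ 4 * g) = (a * g ^ 2) ^ 3 := by ring
    linarith [pow_pos hb 4]
  · have : (a * g ^ 4) ^ 2 * (9 * a ^ 2 * g) ^ 2 = a ^ 3 * g ^ 4 * (81 * (a * g ^ 2) ^ 3) := by ring
    rw [this]
    gcongr
    linarith [pow_pos hb 4]
  · have h4 : a ^ 3 * g ^ 4 ≤ (a * g ^ 2) ^ 3 := by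
      have : g ^ 4 ≤ g ^ 6 := pow_le_pow_right₀ hg (by norm_num)
      calc a ^ 3 * g ^ 4 ≤ a ^ 3 * g ^ 6 := by gcongr
        _ = _ := by ring
    have h5 : a ^ 3 * g ^ 4 ≤ 1 := by linarith
    exact mul_le_one₀ h5 (by positivity) hb4
  · have : g ≤ g ^ 4 := le_self_pow₀ hg (by norm_num)
    calc 9 * a ^ 2 * g ≤ 9 * a ^ 2 * g ^ 4 := by gcongr
      _ = _ := by ring

/-- The error bound for a contraction factor `ρ`, a residual noise term `P = d ebar²` and a target
accuracy `Θ`. -/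
theorem error_bound_le {D R s δ ρ e P Θ α : ℝ} (hs : 0 < s) (hs1 : s ≤ 1) (hδ : 0 ≤ δ)
    (hR : 0 ≤ R) (hD : 1 ≤ D) (hRD : R ^ 2 ≤ D) (hδR : δ * R ≤ s ^ 3) (hα : 0 < α)
    (hαs : α ≤ s ^ 3) (hρ0 : 0 ≤ ρ) (hρ : ρ ≤ (α / D) ^ 2) (hP : P = D * e ^ 2) (hPΘ : P ≤ Θ)
    (hΘ1 : Θ ≤ 1) (hΘ : α * s ^ 2 ≤ Θ) :
    6 * R ^ 2 * (4 * (3 * ρ + 7000 * δ * P / s) + 3 * e ^ 2) ^ 2 + 2 * P ^ 2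
      ≤ 20000000000 * Θ := by
  have hP0 : 0 ≤ P := by rw [hP]; positivity
  have hP2 : P ^ 2 ≤ Θ := by nlinarith
  have h1 : R ^ 2 * ρ ^ 2 ≤ Θ := by
    have h2 : D * ρ ^ 2 ≤ D * ((α / D) ^ 2) ^ 2 := by gcongr
    have h3 : D * ((α / D) ^ 2) ^ 2 = α ^ 4 / D ^ 3 := by field_simp
    have h4 : α ^ 4 / D ^ 3 ≤ α ^ 4 := div_le_self (by positivity) (one_le_pow₀ hD)
    have h5 : α ^ 3 ≤ s ^ 2 := by
      have h6 : s ^ 3 ≤ s := pow_le_of_le_one hs.le hs1 (by norm_num)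
      have h7 : α ≤ s := hαs.trans h6
      calc α ^ 3 ≤ s ^ 3 := by gcongr
        _ ≤ s ^ 2 := pow_le_pow_of_le_one hs.le hs1 (by norm_num)
    calc R ^ 2 * ρ ^ 2 ≤ D * ρ ^ 2 := by gcongr
      _ ≤ α * α ^ 3 := by linarith
      _ ≤ α * s ^ 2 := by gcongr
      _ ≤ Θ := hΘ
  have h2 : R ^ 2 * (δ * P / s) ^ 2 ≤ Θ := by
    have h3 : δ * R / s ≤ 1 := by
      rw [div_le_one hs]
      exact hδR.trans (pow_le_of_le_one hs.le hs1 (by norm_num))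
    calc R ^ 2 * (δ * P / s) ^ 2 = (δ * R / s) ^ 2 * P ^ 2 := by ring
      _ ≤ 1 ^ 2 * P ^ 2 := by gcongr
      _ ≤ Θ := by linarith
  have h3 : R ^ 2 * (e ^ 2) ^ 2 ≤ Θ := by
    calc R ^ 2 * (e ^ 2) ^ 2 ≤ D * (e ^ 2) ^ 2 := by gcongr
      _ ≤ D ^ 2 * (e ^ 2) ^ 2 := by gcongr; nlinarith
      _ = P ^ 2 := by rw [hP]; ring
      _ ≤ Θ := hP2
  have h4 : (4 * (3 * ρ + 7000 * δ * P / s) + 3 * e ^ 2) ^ 2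
      ≤ 3 * (144 * ρ ^ 2 + 784000000 * (δ * P / s) ^ 2 + 9 * (e ^ 2) ^ 2) := by
    have : 7000 * δ * P / s = 7000 * (δ * P / s) := by ring
    rw [this]
    set q := δ * P / s
    nlinarith [sq_nonneg (12 * ρ - 28000 * q), sq_nonneg (12 * ρ - 3 * e ^ 2),
      sq_nonneg (28000 * q - 3 * e ^ 2)]
  have h5 := mul_le_mul_of_nonneg_left h4 (sq_nonneg R)
  have hΘ0 : 0 ≤ Θ := hP0.trans hPΘ
  nlinarith

/-- For a window of step counts compatible with the two time constraints there is a noise radius `e`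
that dominates the noise after the growth phase and is harmless in the contraction phase. -/
theorem exists_noise_radius {D s α Λ : ℝ} (hD : 2 ≤ D) (hs : 0 < s) (hs1 : s ≤ 1) (hα : 0 < α)
    (hL : 1 ≤ Real.log (D / α)) (hΛ : 1000 * Real.log (D / α) ≤ s * Λ)
    (hΛ' : Λ * √(D * α) ≤ √s / 100) :
    ∃ e : ℝ, 0 < e ∧ e ≤ s ^ 2 / 48000 ∧ D * e ^ 2 ≤ α * √D * s ^ 2 ∧ α * √D * s ^ 2 ≤ 1 ∧
      9 * α * Real.exp (Real.log (D / α) / 8) ≤ e ∧ α ≤ s ^ 3 ∧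
      ∀ τ δ : ℝ, 0 ≤ τ → τ ≤ 2 * Λ → 0 ≤ δ → δ ≤ 1 / 300000 →
        τ * (e + 14 * δ * (D * e ^ 2)) ≤ 1 / 2 := by
  have hD0 : 0 < D := by linarith
  -- With `a = √α`, `b = √s` and `g = (D/α)^(1/8)` all quantities are monomials: `√D = a g⁴` and
  -- `√(Dα) = (a g²)²`.
  obtain ⟨a, ha0, rfl⟩ : ∃ a, 0 < a ∧ a ^ 2 = α := ⟨√α, Real.sqrt_pos.2 hα, Real.sq_sqrt hα.le⟩
  obtain ⟨b, hb0, rfl⟩ : ∃ b, 0 < b ∧ b ^ 2 = s := ⟨√s, Real.sqrt_pos.2 hs, Real.sq_sqrt hs.le⟩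
  have hb1 : b ≤ 1 := (sq_le_one_iff₀ hb0.le).1 hs1
  set L := Real.log (D / a ^ 2) with hLdef
  obtain ⟨g, hg⟩ : ∃ g, g = Real.exp (L / 8) := ⟨_, rfl⟩
  have hg1 : 1 ≤ g := hg ▸ Real.one_le_exp (by positivity)
  have hg0 : 0 < g := by linarith
  have hg8 : g ^ 8 = D / a ^ 2 := by
    rw [hg, ← Real.exp_nat_mul, ← Real.exp_log (by positivity : 0 < D / a ^ 2), ← hLdef]
    congr 1
    push_cast; ring
  have hdag : D = (a * g ^ 4) ^ 2 := by
    calc D = a ^ 2 * g ^ 8 := by rw [hg8]; field_simp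
      _ = _ := by ring
  rw [← hg]
  clear_value L
  clear hg hg8 hLdef
  subst hdag
  have hsqrtd : √((a * g ^ 4) ^ 2) = a * g ^ 4 := Real.sqrt_sq (by positivity)
  have hsqrt : √((a * g ^ 4) ^ 2 * a ^ 2) = (a * g ^ 2) ^ 2 := by
    rw [show (a * g ^ 4) ^ 2 * a ^ 2 = ((a * g ^ 2) ^ 2) ^ 2 by ring, Real.sqrt_sq (by positivity)]
  rw [hsqrt, Real.sqrt_sq hb0.le] at hΛ'
  rw [hsqrtd]
  have hag : 1 ≤ a * g ^ 4 := by
    by_contra! h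
    have := pow_le_one₀ (n := 2) (by positivity) h.le
    linarith
  have hb3 := pow_pos hb0 3
  -- Smallness of `√(Dα)` relative to `s^(3/2)`, obtained by multiplying the two time constraints
  -- and using `L ≥ 1`.
  have hu : (a * g ^ 2) ^ 2 ≤ b ^ 3 / 6400 := by
    have h2 : 1000 * (a * g ^ 2) ^ 2 ≤ b ^ 2 * (b / 100) := by
      calc 1000 * (a * g ^ 2) ^ 2 ≤ 1000 * L * (a * g ^ 2) ^ 2 := by gcongr; linarith
        _ ≤ b ^ 2 * Λ * (a * g ^ 2) ^ 2 := by gcongr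
        _ = b ^ 2 * (Λ * (a * g ^ 2) ^ 2) := by ring
        _ ≤ _ := by gcongr
    have h3 : b ^ 2 * (b / 100) = b ^ 3 / 100 := by ring
    linarith
  obtain ⟨he1, he2, he3, he4⟩ := noise_radius_bounds ha0 hg1 hag hb0 hb1 hu
  have hΘ : a ^ 2 * (a * g ^ 4) * (b ^ 2) ^ 2 = a ^ 3 * g ^ 4 * b ^ 4 := by ring
  have hb31 : b ^ 3 ≤ 1 := pow_le_one₀ hb0.le hb1
  have hα : a ^ 2 ≤ (b ^ 2) ^ 3 := by
    calc a ^ 2 = a ^ 2 * 1 := by ring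
      _ ≤ a ^ 2 * (a * g ^ 4) ^ 2 := by gcongr; exact one_le_pow₀ hag
      _ = ((a * g ^ 2) ^ 2) ^ 2 := by ring
      _ ≤ (b ^ 3) ^ 2 := by gcongr; linarith
      _ = _ := by ring
  -- The radius is `9 α (D/α)^(1/8)`: one factor 3 from the growth phase and one from the
  -- convergence phase. The condition `D e² ≤ α √D s²` amounts to `81 (Dα)^(3/4) ≤ s²`.
  refine ⟨9 * a ^ 2 * g, by positivity, by linarith [show (b ^ 2) ^ 2 = b ^ 4 by ring],
    by rw [hΘ]; exact he2, by rw [hΘ]; exact he3, le_rfl, hα, fun τ δ hτ hτ' hδ hδ' => ?_⟩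
  have h1 : (a * g ^ 4) ^ 2 * (9 * a ^ 2 * g) ^ 2 ≤ 81 * (a * g ^ 2) ^ 2 := by
    calc (a * g ^ 4) ^ 2 * (9 * a ^ 2 * g) ^ 2 = 81 * a ^ 6 * g ^ 10 := by ring
      _ ≤ 81 * a ^ 6 * g ^ 12 := by
          gcongr ?_ * ?_
          exact pow_le_pow_right₀ hg1 (by norm_num)
      _ = 81 * (a * g ^ 2) ^ 6 := by ring
      _ ≤ 81 * (a * g ^ 2) ^ 2 := by
          gcongr ?_ * ?_
          exact pow_le_pow_of_le_one (by positivity)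
            ((sq_le_one_iff₀ (by positivity)).1 (by linarith)) (by norm_num)
  have h2 : 14 * δ * ((a * g ^ 4) ^ 2 * (9 * a ^ 2 * g) ^ 2)
      ≤ 14 * (1 / 300000) * (81 * (a * g ^ 2) ^ 2) := by gcongr
  have h3 : 0 ≤ (a * g ^ 2) ^ 2 := by positivity
  calc τ * (9 * a ^ 2 * g + 14 * δ * ((a * g ^ 4) ^ 2 * (9 * a ^ 2 * g) ^ 2))
      ≤ 2 * Λ * (10 * (a * g ^ 2) ^ 2) := by gcongr <;> linarith
    _ = 20 * (Λ * (a * g ^ 2) ^ 2) := by ring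
    _ ≤ _ := by linarith

/-- The convergence bound in terms of the smallest nonzero eigenvalue of the target. -/
theorem gradientDescent_error_le {A : Fin m → Matrix (Fin d) (Fin d) ℝ} {r : ℕ}
    {X B : Matrix (Fin d) (Fin d) ℝ} {y : Fin m → ℝ} {s δ α η : ℝ} (hd : 2 ≤ d)
    (hX : X.PosSemidef) (hXr : X.rank = r) (h1 : specNorm X = 1) (hs : s = sigma X.rank X)
    (hA : ∀ i, (A i).IsSymm) (hy : ∀ i, y i = matInner (A i) X) (hrip : RIP A (4 * r) δ)
    (hδr : δ * √r ≤ s ^ 3 / 300000) (hB : B ∈ Matrix.orthogonalGroup (Fin d) ℝ) (hα : 0 < α)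
    (hαd : d * α ≤ 1) (hη : 0 < η) (hηδ : η ≤ δ) {T : ℕ}
    (hT : 1000 * Real.log (d / α) ≤ s * (η * T))
    (hT' : η * T * √(d * α) ≤ √s / 100) :
    ‖gradientDescent (loss A y) η (α • B) T * (gradientDescent (loss A y) η (α • B) T)ᵀ - X‖ ^ 2
      ≤ 20000000000 * (α * √d * s ^ 2) := by
  have hδ : 0 < δ := hη.trans_le hηδ
  have htraj := isTrajectory_gradientDescent (η := η) hX hXr h1 hA hy hrip hδ.le hB hα
  rw [← hs] at htraj
  have hr : 1 ≤ r := hXr ▸ rank_pos_of_specNorm h1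
  have hs0 : 0 < s := hs ▸ sigma_rank_pos (hXr.symm ▸ hr)
  have hs1 : s ≤ 1 := hs ▸ sigma_rank_le_one hX h1
  have hrd : r ≤ d := by rw [← hXr]; simpa using X.rank_le_card_width
  have hd2 : (2 : ℝ) ≤ d := by exact_mod_cast hd
  have hR1 : 1 ≤ √(r : ℝ) := Real.one_le_sqrt.2 (by exact_mod_cast hr)
  have hRsq : √(r : ℝ) ^ 2 = r := Real.sq_sqrt (by positivity)
  have hrd' : √(r : ℝ) ^ 2 ≤ d := by rw [hRsq]; exact_mod_cast hrd
  have hL1 : 1 ≤ Real.log (d / α) := by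
    rw [Real.le_log_iff_exp_le (by positivity), le_div_iff₀ hα]
    have := Real.exp_one_lt_d9
    have h2 : α ≤ 1 / 2 := by nlinarith
    nlinarith
  obtain ⟨e, he0, he1, he2, he3, he4, hαs, hn⟩ := exists_noise_radius hd2 hs0 hs1 hα hL1 hT hT'
  have hP1 : d * e ^ 2 ≤ 1 := he2.trans he3
  have hs3 : s ^ 3 ≤ s := pow_le_of_le_one hs0.le hs1 (by norm_num)
  have hs32 : s ^ 3 ≤ s ^ 2 := pow_le_pow_of_le_one hs0.le hs1 (by norm_num)
  have hδs : δ ≤ s ^ 3 / 300000 := (le_mul_of_one_le_right hδ.le hR1).trans hδr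
  have hx1 : 2 * η * s ≤ 1 := by
    calc 2 * η * s ≤ 2 * η * 1 := by gcongr
      _ ≤ 1 := by linarith
  have hδP : δ * (d * e ^ 2) ≤ δ * √r := by gcongr; linarith
  obtain ⟨t, n, rfl, h2, h3, h4⟩ := exists_phase_split (D := d) (x := 2 * η * s) hα (by positivity)
    hL1 (by positivity) hx1 (T := T) (by linarith)
  have hηn : 2 * η * n ≤ 2 * (η * (t + n : ℕ)) := by
    rw [mul_assoc]; gcongr; omega
  obtain ⟨S, hS, hnoise, hres⟩ := htraj.final_bound (ebar := e) (t := t) (n := n) hs0 hs1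
    (by positivity) (by linarith) hδ.le hα
    (Real.sqrt_le_iff.2 ⟨by positivity, by
      exact_mod_cast hrd.trans (Nat.le_self_pow two_ne_zero d)⟩)
    he1 (by linarith) (by linarith)
    (by
      have : α * (1 + 2 * η * s / 4000) ^ t ≤ α * (3 * Real.exp (Real.log (d / α) / 8)) := by gcongr
      linarith)
    (by
      have h5 : √(s / 20) ≤ 1 := Real.sqrt_le_one.2 (by linarith)
      have h6 : α * (d / α) ≤ α * (1 + 2 * η * s / 10) ^ t := by gcongr
      have h7 : α * (d / α) = d := by field_simp
      linarith) (hn _ _ (by positivity) hηn hδ.le (by linarith))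
  refine (norm_sq_sub_le hXr.le hS hnoise he0.le hres).trans ?_
  rw [← hRsq]
  refine error_bound_le hs0 hs1 hδ.le (by positivity) (by linarith) hrd'
    (by linarith [pow_pos hs0 3]) hα hαs (pow_nonneg (by linarith) n) h4 rfl he2 he3 ?_
  calc α * s ^ 2 ≤ α * s ^ 2 * √d :=
        le_mul_of_one_le_right (by positivity) (Real.one_le_sqrt.2 (by linarith))
    _ = _ := by ring

end

end MatrixSensing

end

theorem theorem1 :
    ∃ c C₁ C₂ C₃ : ℝ, 0 < c ∧ 0 < C₁ ∧ 0 < C₂ ∧ 0 < C₃ ∧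
      ∀ (d m r : ℕ) (A : Fin m → Matrix (Fin d) (Fin d) ℝ) (X B : Matrix (Fin d) (Fin d) ℝ)
        (y : Fin m → ℝ) (κ δ α η : ℝ),
        2 ≤ d →
        -- the unknown matrix: positive semidefinite, rank `r`, spectral norm one
        X.PosSemidef → X.rank = r → MatrixSensing.specNorm X = 1 →
        κ = MatrixSensing.condNumber X →
        -- the symmetric measurements and the labels
        (∀ i, (A i).IsSymm) →
        (∀ i, y i = MatrixSensing.matInner (A i) X) →
        MatrixSensing.RIP A (4 * r) δ →
        δ ≤ c / (κ ^ 3 * √(r : ℝ) * Real.log d ^ 2) →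
        -- the initialization and the step size
        B ∈ Matrix.orthogonalGroup (Fin d) ℝ →
        0 < α → α ≤ c * min (δ * √(r : ℝ) * κ) (1 / (d : ℝ)) →
        0 < η → η ≤ c * δ →
        ∀ T : ℕ,
          C₁ * (κ * Real.log (d / α) / η) ≤ T →
          (T : ℝ) ≤ C₂ * (1 / (η * √(d * κ * α))) →
          let U := MatrixSensing.gradientDescent (MatrixSensing.loss A y) η (α • B)
          ‖U T * (U T)ᵀ - X‖ ^ 2 ≤ C₃ * (α * √(d : ℝ) / κ ^ 2) := by
  refine ⟨1 / 1000000, 1000, 1 / 100, 20000000000, by norm_num, by norm_num, by norm_num,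
    by norm_num, ?_⟩
  intro d m r A X B y κ δ α η hd hX hXr h1 hκ hA hy hrip hδ hB hα hα' hη hη' T hT hT' U
  have hr : 1 ≤ r := hXr ▸ MatrixSensing.rank_pos_of_specNorm h1
  set s := MatrixSensing.sigma X.rank X with hs
  have hs0 : 0 < s := MatrixSensing.sigma_rank_pos (hXr.symm ▸ hr)
  have hκs : κ = 1 / s := hκ
  have hκ0 : 0 < κ := hκs ▸ by positivity
  have hd2 : (2 : ℝ) ≤ d := by exact_mod_cast hd
  have hR0 : 0 < √(r : ℝ) := Real.sqrt_pos.2 (by exact_mod_cast hr)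
  -- `(log 2)² ≈ 0.48`, so the logarithm is traded for a constant.
  have hlog : 1 / 3 ≤ Real.log d ^ 2 := by
    have h2 := Real.log_two_gt_d9
    have h3 : Real.log 2 ≤ Real.log d := Real.log_le_log (by norm_num) hd2
    nlinarith
  have hδ0 : 0 < δ := by linarith
  have hδr : δ * √r ≤ s ^ 3 / 300000 := by
    rw [le_div_iff₀ (by positivity), hκs] at hδ
    have h2 : δ * √r * Real.log d ^ 2 ≤ s ^ 3 / 1000000 := by
      calc δ * √r * Real.log d ^ 2
          = δ * ((1 / s) ^ 3 * √r * Real.log d ^ 2) * s ^ 3 := by field_simp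
        _ ≤ 1 / 1000000 * s ^ 3 := by gcongr
        _ = _ := by ring
    have h3 : δ * √r * (1 / 3) ≤ δ * √r * Real.log d ^ 2 := by gcongr
    have h4 := pow_pos hs0 3
    linarith
  have hαd : d * α ≤ 1 := by
    have h2 : α ≤ 1 / 1000000 * (1 / d) := hα'.trans (by gcongr; exact min_le_right _ _)
    calc d * α ≤ d * (1 / 1000000 * (1 / d)) := by gcongr
      _ = 1 / 1000000 := by field_simp
      _ ≤ 1 := by norm_num
  -- Since `κ s = 1`, the upper bound on `T` becomes `η T √(dα) ≤ √s / 100`.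
  have hsq : √(d * κ * α) * √s = √(d * α) := by
    rw [← Real.sqrt_mul (by positivity), hκs]
    congr 1; field_simp
  have hq : 0 < √(d * κ * α) := Real.sqrt_pos.2 (by positivity)
  have h3 := MatrixSensing.gradientDescent_error_le (η := η) (T := T) hd hX hXr h1 hs hA hy hrip
    hδr hB hα hαd hη (by linarith)
    (by
      rw [hκs] at hT
      calc 1000 * Real.log (d / α)
          = s * (η * (1000 * (1 / s * Real.log (d / α) / η))) := by field_simp
        _ ≤ _ := by gcongr)
    (by
      rw [← hsq]
      calc η * T * (√(d * κ * α) * √s)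
          ≤ η * (1 / 100 * (1 / (η * √(d * κ * α)))) * (√(d * κ * α) * √s) := by gcongr
        _ = √s / 100 := by field_simp)
  have h4 : α * √(d : ℝ) / κ ^ 2 = α * √d * s ^ 2 := by rw [hκs]; field_simp
  rw [h4]
  exact h3
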